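/- Let $\mathbb K=\mathbb R$ or $\mathbb C$, and let $A=(a_{j,k})_{j,k\ge1}$ be a matrix with $a_{j,k}>0$ and $a_{j,k}\le a_{j+1,k}$ for all $j,k\ge1$. Let $X$ be one of the Köthe sequence spaces $$\lambda^p(A)=\Big\{(x_k)\in\mathbb K^{\mathbb N}: p_j(x)=\Big(\sum_{k\ge1}|x_ka_{j,k}|^p\Big)^{1/p}<\infty\ \text{for all } j\ge1\Big\}\quad(1\le p<\infty),$$ $$c_0(A)=\Big\{(x_k)\in\mathbb K^{\mathbb N}: \lim_{k\to\infty}|x_k|a_{j,k}=0\ \text{for all } j\ge1\Big\},\qquad p_j(x)=\max_k|x_k|a_{j,k},$$ with the topology defined by the norms $p_j$, $j\ge 1$, and let $(e_k)_{k\ge1}$ be the canonical unit sequences. Let $(w_k)_{k\ge1}$ be non-zero scalars such that the weighted shift $B_we_k=w_ke_{k-1}$ ($e_0=0$) is a continuous linear operator $B_w:X\to X$. Let $P$ be a non-constant polynomial over $\mathbb K$ such that $T=P(B_w)$ satisfies the Hypercyclicity Criterion, i.e. there are dense sets $X_0,Y_0\subset X$, a strictly increasing sequence of non-negative integers $(n_k)$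 and maps $S_k:Y_0\to X$ such that $T^{n_k}x\to0$ for all $x\in X_0$, and $S_ky\to0$ and $T^{n_k}S_ky\to y$ for all $y\in Y_0$. Let $J\ge1$. (I) Suppose that (a) for all $m,j\ge1$ there is $m_j\ge1$ with $\displaystyle\sup_{n\ge0}\limsup_{k>n}\frac{p_j(e_{k-n})\,p_m(e_k)}{p_J(e_{k-n})\,p_{m_j}(e_k)}<\infty$; (b) there is $m\ge1$ such that for every $n\ge1$, $\displaystyle\inf_{k\ge n+1}\frac{p_J(B_w^ne_k)}{p_m(e_k)}=0$; (c) $|P(0)|\le1$, or there is $m\ge1$ with $\displaystyle\lim_{k\to\infty}\frac{p_J(e_k)}{p_m(e_k)}=0$. Then $P(B_w)$ has a hypercyclic subspace, i.e. there is an infinite-dimensional closed subspace $M\subset X$ such that for every $x\in M\setminus\{0\}$ the set $\{P(B_w)^nx:n\ge1\}$ is dense in $X$. (II) Suppose that (a) for all $m,j\ge1$ there is $m_j\ge1$ with $\displaystyle\sup_{n\ge0}\limsup_{k\to\infty}\frac{a_{j,k}\,a_{m,n+k}}{a_{J,k}\,a_{m_j,n+k}}<\infty$; (b) there is $m\ge1$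 such that for every $n\ge1$, $\displaystyle\inf_{k\ge1}\frac{\prod_{\nu=1}^n|w_{\nu+k}|\,a_{J,k}}{a_{m,n+k}}=0$; (c) $|P(0)|\le1$, or there is $m\ge1$ with $\displaystyle\lim_{k\to\infty}\frac{a_{J,k}}{a_{m,k}}=0$. Then $P(B_w)$ has a hypercyclic subspace. -/

import Mathlib

open Filter Topology Polynomial
open scoped ENNReal

noncomputable section

/-! ### Köthe matrices and Köthe sequence spaces

Rows, columns, coordinates and weights are numbered from `0` instead of from `1`:
`A.a j k` is `a_{j+1,k+1}`, `x k` is `x_{k+1}`, `w k` is `w_{k+1}`, and `e k` is `e_{k+1}`. -/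

/-- A Köthe matrix: strictly positive entries, nondecreasing in the row index. -/
structure KotheMatrix where
  a : ℕ → ℕ → ℝ
  pos : ∀ j k, 0 < a j k
  mono : ∀ j k, a j k ≤ a (j + 1) k

/-- The two families of spaces: `λ^p(A)` with `1 ≤ p < ∞`, and `c₀(A)`. -/
inductive KotheKind where
  | lam (p : ℝ) (hp : 1 ≤ p) : KotheKind
  | czero : KotheKind

variable {𝕜 : Type*} [RCLike 𝕜]

/-- Membership of a scalar sequence in `λ^p(A)`, resp. `c₀(A)`. -/
def IsKothe (κ : KotheKind) (A : KotheMatrix) (x : ℕ → 𝕜) : Prop :=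
  match κ with
  | .lam p _ => ∀ j, Summable fun k => (‖x k‖ * A.a j k) ^ p
  | .czero => ∀ j, Tendsto (fun k => ‖x k‖ * A.a j k) atTop (𝓝 0)

/-- The `j`-th norm `(∑ |x_k a_{j,k}|^p)^{1/p}`, resp. `sup_k |x_k| a_{j,k}`. -/
def kotheNorm (κ : KotheKind) (A : KotheMatrix) (j : ℕ) (x : ℕ → 𝕜) : ℝ :=
  match κ with
  | .lam p _ => (∑' k, (‖x k‖ * A.a j k) ^ p) ^ (1 / p)
  | .czero => ⨆ k, ‖x k‖ * A.a j k

lemma KotheMatrix.term_nonneg (A : KotheMatrix) (j k : ℕ) (x : 𝕜) : 0 ≤ ‖x‖ * A.a j k :=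
  mul_nonneg (norm_nonneg _) (A.pos j k).le

lemma KotheMatrix.term_add_le (A : KotheMatrix) (j k : ℕ) (x y : 𝕜) :
    ‖x + y‖ * A.a j k ≤ ‖x‖ * A.a j k + ‖y‖ * A.a j k := by
  rw [← add_mul]
  exact mul_le_mul_of_nonneg_right (norm_add_le _ _) (A.pos j k).le

lemma IsKothe.zero (κ : KotheKind) (A : KotheMatrix) : IsKothe κ A (0 : ℕ → 𝕜) := by
  cases κ with
  | lam p hp =>
    intro j
    have h0 : p ≠ 0 := by linarith
    simp [Real.zero_rpow h0]
  | czero => intro j; simp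

lemma IsKothe.add {κ : KotheKind} {A : KotheMatrix} {x y : ℕ → 𝕜}
    (hx : IsKothe κ A x) (hy : IsKothe κ A y) : IsKothe κ A (x + y) := by
  cases κ with
  | lam p hp =>
    intro j
    refine Summable.of_nonneg_of_le
      (fun k => Real.rpow_nonneg (A.term_nonneg j k _) p)
      (fun k => Real.rpow_le_rpow (A.term_nonneg j k _) (A.term_add_le j k (x k) (y k))
        (by linarith))
      (Real.Lp_add_le_tsum_of_nonneg hp (fun k => A.term_nonneg j k (x k))
        (fun k => A.term_nonneg j k (y k)) (hx j) (hy j)).1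
  | czero =>
    intro j
    refine squeeze_zero (fun k => A.term_nonneg j k _)
      (fun k => A.term_add_le j k (x k) (y k)) ?_
    simpa using (hx j).add (hy j)

lemma IsKothe.smul {κ : KotheKind} {A : KotheMatrix} (c : 𝕜) {x : ℕ → 𝕜}
    (hx : IsKothe κ A x) : IsKothe κ A (c • x) := by
  cases κ with
  | lam p hp =>
    intro j
    refine ((hx j).mul_left (‖c‖ ^ p)).congr fun k => ?_
    rw [← Real.mul_rpow (norm_nonneg _) (A.term_nonneg j k _)]
    simp [mul_assoc]
  | czero =>
    intro j
    have := (hx j).const_mul ‖c‖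
    simpa [mul_assoc] using this

lemma IsKothe.bddAbove {A : KotheMatrix} {x : ℕ → 𝕜} (hx : IsKothe .czero A x) (j : ℕ) :
    BddAbove (Set.range fun k => ‖x k‖ * A.a j k) :=
  (hx j).bddAbove_range

variable (𝕜) in
/-- The Köthe space as a vector space of sequences. -/
def kotheSubmodule (κ : KotheKind) (A : KotheMatrix) : Submodule 𝕜 (ℕ → 𝕜) where
  carrier := {x | IsKothe κ A x}
  zero_mem' := IsKothe.zero κ A
  add_mem' := fun hx hy => hx.add hy
  smul_mem' := fun c _ hx => hx.smul c

variable (𝕜) in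
/-- The Köthe space `λ^p(A)`, resp. `c₀(A)`. This is a type of its own, so that it does not
carry the topology of coordinatewise convergence. -/
def KotheSpace (κ : KotheKind) (A : KotheMatrix) : Type _ := ↥(kotheSubmodule 𝕜 κ A)

instance (κ : KotheKind) (A : KotheMatrix) : AddCommGroup (KotheSpace 𝕜 κ A) :=
  inferInstanceAs (AddCommGroup ↥(kotheSubmodule 𝕜 κ A))

instance (κ : KotheKind) (A : KotheMatrix) : Module 𝕜 (KotheSpace 𝕜 κ A) :=
  inferInstanceAs (Module 𝕜 ↥(kotheSubmodule 𝕜 κ A))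

/-- The sequence of coordinates of an element of a Köthe space. -/
def KotheSpace.coord {κ : KotheKind} {A : KotheMatrix} (x : KotheSpace 𝕜 κ A) : ℕ → 𝕜 :=
  Subtype.val (p := fun x : ℕ → 𝕜 => x ∈ kotheSubmodule 𝕜 κ A) x

variable (𝕜) in
/-- The norm `p_j` on the Köthe space, as a bundled seminorm. -/
def kotheSeminorm (κ : KotheKind) (A : KotheMatrix) (j : ℕ) :
    Seminorm 𝕜 (KotheSpace 𝕜 κ A) :=
  Seminorm.of (fun x => kotheNorm κ A j x.coord)
    (by
      rintro ⟨x, hx⟩ ⟨y, hy⟩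
      change kotheNorm κ A j (x + y) ≤ kotheNorm κ A j x + kotheNorm κ A j y
      replace hx : IsKothe κ A x := hx
      replace hy : IsKothe κ A y := hy
      cases κ with
      | lam p hp =>
        have h0 : (0 : ℝ) ≤ 1 / p := by positivity
        refine le_trans (Real.rpow_le_rpow
          (tsum_nonneg fun k => Real.rpow_nonneg (A.term_nonneg j k _) p) ?_ h0)
          (Real.Lp_add_le_tsum_of_nonneg hp (fun k => A.term_nonneg j k (x k))
            (fun k => A.term_nonneg j k (y k)) (hx j) (hy j)).2
        refine Summable.tsum_le_tsum
          (fun k => Real.rpow_le_rpow (A.term_nonneg j k _) (A.term_add_le j k (x k) (y k))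
            (by linarith)) ((hx.add hy) j)
          (Real.Lp_add_le_tsum_of_nonneg hp (fun k => A.term_nonneg j k (x k))
            (fun k => A.term_nonneg j k (y k)) (hx j) (hy j)).1
      | czero =>
        refine ciSup_le fun k => (A.term_add_le j k (x k) (y k)).trans ?_
        exact add_le_add (le_ciSup (hx.bddAbove j) k) (le_ciSup (hy.bddAbove j) k))
    (by
      rintro c ⟨x, hx⟩
      change kotheNorm κ A j (c • x) = ‖c‖ * kotheNorm κ A j x
      cases κ with
      | lam p hp =>
        have h0 : p ≠ 0 := by linarith
        have h1 : ∀ k, (‖(c • x) k‖ * A.a j k) ^ p = ‖c‖ ^ p * (‖x k‖ * A.a j k) ^ p := by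
          intro k
          rw [← Real.mul_rpow (norm_nonneg _) (A.term_nonneg j k _)]
          simp [mul_assoc]
        simp only [kotheNorm, h1]
        rw [tsum_mul_left, Real.mul_rpow (Real.rpow_nonneg (norm_nonneg _) p)
          (tsum_nonneg fun k => Real.rpow_nonneg (A.term_nonneg j k _) p),
          ← Real.rpow_mul (norm_nonneg _), mul_one_div_cancel h0, Real.rpow_one]
      | czero =>
        simp only [kotheNorm]
        rw [Real.mul_iSup_of_nonneg (norm_nonneg _)]
        simp [mul_assoc])

/-- The Fréchet topology of the Köthe space: the locally convex topology defined by the norms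
`p_j`. -/
instance (κ : KotheKind) (A : KotheMatrix) : TopologicalSpace (KotheSpace 𝕜 κ A) :=
  SeminormFamily.moduleFilterBasis (𝕜 := 𝕜) (kotheSeminorm 𝕜 κ A) |>.topology

lemma KotheSpace.withSeminorms (κ : KotheKind) (A : KotheMatrix) :
    WithSeminorms (kotheSeminorm 𝕜 κ A) := ⟨rfl⟩

instance (κ : KotheKind) (A : KotheMatrix) : IsTopologicalAddGroup (KotheSpace 𝕜 κ A) :=
  (KotheSpace.withSeminorms (𝕜 := 𝕜) κ A).topologicalAddGroup

instance (κ : KotheKind) (A : KotheMatrix) : ContinuousSMul 𝕜 (KotheSpace 𝕜 κ A) :=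
  (KotheSpace.withSeminorms (𝕜 := 𝕜) κ A).continuousSMul

lemma IsKothe.single (κ : KotheKind) (A : KotheMatrix) (n : ℕ) :
    IsKothe κ A (Pi.single n (1 : 𝕜)) := by
  cases κ with
  | lam p hp =>
    intro j
    refine summable_of_ne_finset_zero (s := {n}) fun k hk => ?_
    have h0 : p ≠ 0 := by linarith
    have hk' : k ≠ n := by simpa using hk
    simp [hk', Real.zero_rpow h0]
  | czero =>
    intro j
    refine tendsto_const_nhds.congr' ?_
    filter_upwards [eventually_gt_atTop n] with k hk
    simp [hk.ne']

variable (𝕜) in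
/-- The canonical unit sequence `e_n` in the Köthe space. -/
def KotheSpace.e (κ : KotheKind) (A : KotheMatrix) (n : ℕ) : KotheSpace 𝕜 κ A :=
  (⟨Pi.single n 1, IsKothe.single κ A n⟩ : ↥(kotheSubmodule 𝕜 κ A))

/-- The operator `B` is the weighted (backward) shift `B_w e_n = w_n e_{n-1}`
(with `e_{-1} = 0`) for the sequence `w` of non-zero weights. -/
structure IsWeightedShift {κ : KotheKind} {A : KotheMatrix} (w : ℕ → 𝕜)
    (B : KotheSpace 𝕜 κ A →L[𝕜] KotheSpace 𝕜 κ A) : Prop where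
  weight_ne_zero : ∀ n, w n ≠ 0
  coord_apply : ∀ x k, (B x).coord k = w (k + 1) * x.coord (k + 1)

/-! ### Notions of linear dynamics -/

section Dynamics

variable {E : Type*} [AddCommGroup E] [Module 𝕜 E] [TopologicalSpace E]

/-- The Hypercyclicity Criterion for a continuous linear operator. -/
def SatisfiesHypercyclicityCriterion (T : E →L[𝕜] E) : Prop :=
  ∃ (X₀ Y₀ : Set E) (n : ℕ → ℕ) (S : ℕ → E → E),
    Dense X₀ ∧ Dense Y₀ ∧ StrictMono n ∧
    (∀ x ∈ X₀, Tendsto (fun k => (T ^ n k) x) atTop (𝓝 0)) ∧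
    (∀ y ∈ Y₀, Tendsto (fun k => S k y) atTop (𝓝 0)) ∧
    (∀ y ∈ Y₀, Tendsto (fun k => (T ^ n k) (S k y)) atTop (𝓝 y))

/-- A vector is hypercyclic for `T` if its orbit `{T^n x : n ≥ 1}` is dense. -/
def IsHypercyclicVector (T : E →L[𝕜] E) (x : E) : Prop :=
  Dense {y : E | ∃ n : ℕ, 1 ≤ n ∧ (T ^ n) x = y}

/-- `T` has a hypercyclic subspace: an infinite-dimensional closed subspace all of whose
non-zero vectors are hypercyclic. -/
def HasHypercyclicSubspace (T : E →L[𝕜] E) : Prop :=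
  ∃ M : Submodule 𝕜 E, IsClosed (M : Set E) ∧ ¬ FiniteDimensional 𝕜 M ∧
    ∀ x ∈ M, x ≠ 0 → IsHypercyclicVector T x

end Dynamics

end

/-! Write `T = P(B)` and `α j k = a j k / weightProd w k`. In these renormalised columns the shift
is unweighted: `p_j(B^i e_k) = weightProd w k * α j (k - i)`. Hypothesis (b) makes a single iterate
small along some indices. The first half of the proof upgrades this to finitely many iterates at
once (`exists_frequently_forall_le`), by contradiction: if for each row `m` some bounded iterate
always stayed large, chaining such iterates would bound `α J k` below by a multiple of `α m (n + k)`
for one fixed `n`, using (a) and continuity of `B`, and (b) would fail. Expanding `P^n` in powers of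
`B`, with (c) handling the constant term, gives scalars `|c n| ≤ 1` such that `T^n e_k - c n • e_k`
is small relative to `a (μ j) k` for infinitely many `k`, uniformly over finitely many `n` and `j`;
the row `μ j` does not depend on how many.

The second half works for any `T` with this property and the Hypercyclicity Criterion
(`KotheSpace.hasHypercyclicSubspace`). Unit sequences `u_i`, normalized for `p_0` and supported at
sparse indices, are replaced by nearby `v_i ∈ X₀`, and small `z_i ∈ X₀` with `T^(n_i) z_i ≈ y_i` are
added. The map `x ↦ x + ∑ (a_i(x)(v_i - u_i) + a_(l i)(x) z_i)` is a perturbation of the identity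
that is bounded below in every norm, so the image of the closed span of the `u_i` is closed and
infinite-dimensional.

Apply `T^(n_s)` to an image vector. Terms with `i < s` are small because they lie in `X₀`. In the
terms with `i ≥ s` the unit sequences contribute nearly `c` times a tail of `x`, which tends to `0`
since `|c| ≤ 1`. What remains is `a_(l s)(x) y_s`. As `(l s, y_s)` takes each pair (index, member of
a dense sequence) arbitrarily late, a single nonzero coefficient of `x` already makes the orbit
dense. -/

noncomputable section

variable {𝕜 : Type*} [RCLike 𝕜]

/-! ### Köthe spaces as Fréchet spaces with a basis -/

/-- The inequality `p_j(y) ≤ C` expressed by finitely many coordinates at a time; it makes sense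
for sequences which need not belong to the Köthe space. -/
def KotheBound (κ : KotheKind) (A : KotheMatrix) (j : ℕ) (C : ℝ) (y : ℕ → 𝕜) : Prop :=
  match κ with
  | .lam p _ => ∀ F : Finset ℕ, ∑ k ∈ F, (‖y k‖ * A.a j k) ^ p ≤ C ^ p
  | .czero => ∀ k, ‖y k‖ * A.a j k ≤ C

section KotheBound

variable {κ : KotheKind} {A : KotheMatrix} {j : ℕ} {C : ℝ} {y : ℕ → 𝕜}

lemma kotheNorm_nonneg (κ : KotheKind) (A : KotheMatrix) (j : ℕ) (y : ℕ → 𝕜) :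
    0 ≤ kotheNorm κ A j y := by
  cases κ with
  | lam p hp =>
    exact Real.rpow_nonneg (tsum_nonneg fun k => Real.rpow_nonneg (A.term_nonneg j k _) p) _
  | czero => exact Real.iSup_nonneg fun k => A.term_nonneg j k _

lemma IsKothe.kotheBound (hy : IsKothe κ A y) (j : ℕ) :
    KotheBound κ A j (kotheNorm κ A j y) y := by
  cases κ with
  | lam p hp =>
    intro F
    have h0 : p ≠ 0 := by linarith
    have hn : ∀ k, 0 ≤ (‖y k‖ * A.a j k) ^ p := fun k =>
      Real.rpow_nonneg (A.term_nonneg j k _) p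
    simp only [kotheNorm]
    rw [← Real.rpow_mul (tsum_nonneg hn), one_div_mul_cancel h0, Real.rpow_one]
    exact (hy j).sum_le_tsum F fun k _ => hn k
  | czero => exact fun k => le_ciSup (hy.bddAbove j) k

lemma KotheBound.mono {D : ℝ} (h : KotheBound κ A j C y) (hC : 0 ≤ C) (hCD : C ≤ D) :
    KotheBound κ A j D y := by
  cases κ with
  | lam p hp => exact fun F => (h F).trans (Real.rpow_le_rpow hC hCD (by linarith))
  | czero => exact fun k => (h k).trans hCD

lemma KotheBound.kotheNorm_le (hC : 0 ≤ C) (h : KotheBound κ A j C y) :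
    kotheNorm κ A j y ≤ C := by
  cases κ with
  | lam p hp =>
    have h0 : 0 < p := by linarith
    have hn : ∀ k, 0 ≤ (‖y k‖ * A.a j k) ^ p := fun k =>
      Real.rpow_nonneg (A.term_nonneg j k _) p
    simp only [kotheNorm]
    rw [one_div, Real.rpow_inv_le_iff_of_pos (tsum_nonneg hn) hC h0]
    exact Real.tsum_le_of_sum_le hn h
  | czero => exact ciSup_le h

lemma KotheBound.coord_le (hC : 0 ≤ C) (h : KotheBound κ A j C y) (k : ℕ) :
    ‖y k‖ * A.a j k ≤ C := by
  cases κ with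
  | lam p hp =>
    have h0 : 0 < p := by linarith
    have := h {k}
    rw [Finset.sum_singleton] at this
    exact (Real.rpow_le_rpow_iff (A.term_nonneg j k _) hC h0).1 this
  | czero => exact h k

/-- A bound tested on finitely many coordinates at a time survives coordinatewise limits, even
before the limit is known to lie in the space. This is what yields completeness. -/
lemma KotheBound.of_tendsto {u : ℕ → ℕ → 𝕜} (hu : ∀ k, Tendsto (fun n => u n k) atTop (𝓝 (y k)))
    (h : ∀ᶠ n in atTop, KotheBound κ A j C (u n)) : KotheBound κ A j C y := by
  have ht : ∀ k, Tendsto (fun n => ‖u n k‖ * A.a j k) atTop (𝓝 (‖y k‖ * A.a j k)) :=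
    fun k => (hu k).norm.mul_const _
  cases κ with
  | lam p hp =>
    have h0 : 0 ≤ p := by linarith
    intro F
    refine le_of_tendsto (tendsto_finsetSum F fun k _ => (ht k).rpow_const (Or.inr h0)) ?_
    filter_upwards [h] with n hn using hn F
  | czero =>
    intro k
    refine le_of_tendsto (ht k) ?_
    filter_upwards [h] with n hn using hn k

lemma IsKothe.of_approx
    (h : ∀ j, ∀ ε > 0, ∃ x : ℕ → 𝕜, IsKothe κ A x ∧ KotheBound κ A j ε (y - x)) :
    IsKothe κ A y := by
  cases κ with
  | lam p hp =>
    intro j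
    obtain ⟨x, hx, hyx⟩ := h j 1 one_pos
    have hs : Summable fun k => (‖(y - x) k‖ * A.a j k) ^ p :=
      summable_of_sum_le (fun k => Real.rpow_nonneg (A.term_nonneg j k _) p) hyx
    refine Summable.of_nonneg_of_le
      (fun k => Real.rpow_nonneg (A.term_nonneg j k _) p)
      (fun k => Real.rpow_le_rpow (A.term_nonneg j k _) ?_ (by linarith))
      (Real.Lp_add_le_tsum_of_nonneg hp (fun k => A.term_nonneg j k ((y - x) k))
        (fun k => A.term_nonneg j k (x k)) hs (hx j)).1
    simpa using A.term_add_le j k ((y - x) k) (x k)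
  | czero =>
    intro j
    rw [Metric.tendsto_atTop]
    intro ε hε
    obtain ⟨x, hx, hyx⟩ := h j (ε / 2) (by positivity)
    obtain ⟨N, hN⟩ := (Metric.tendsto_atTop.1 (hx j)) (ε / 2) (by positivity)
    refine ⟨N, fun n hn => ?_⟩
    have h1 := hN n hn
    have h2 := hyx n
    have h3 := A.term_add_le j n ((y - x) n) (x n)
    simp only [Real.dist_eq, sub_zero, Pi.sub_apply, sub_add_cancel] at *
    rw [abs_of_nonneg (A.term_nonneg j n _)] at *
    linarith

/-- Tails of `y` are uniformly small. The condition on `z` admits every truncation of `y` off `s`,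
up to sign, so it applies to the error of a partial sum. -/
lemma IsKothe.kotheBound_truncate (hy : IsKothe κ A y) (j : ℕ) {ε : ℝ} (hε : 0 < ε) :
    ∃ s : Finset ℕ, ∀ z : ℕ → 𝕜, (∀ k ∈ s, z k = 0) → (∀ k, z k = 0 ∨ ‖z k‖ = ‖y k‖) →
      KotheBound κ A j ε z := by
  cases κ with
  | lam p hp =>
    have h0 : p ≠ 0 := by linarith
    obtain ⟨s, hs⟩ := summable_iff_vanishing_norm.1 (hy j) (ε ^ p) (Real.rpow_pos_of_pos hε p)
    refine ⟨s, fun z hz hzy F => ?_⟩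
    have hn : ∀ k, 0 ≤ (‖y k‖ * A.a j k) ^ p := fun k =>
      Real.rpow_nonneg (A.term_nonneg j k _) p
    have h1 := hs (F \ s) Finset.sdiff_disjoint
    rw [Real.norm_of_nonneg (Finset.sum_nonneg fun k _ => hn k)] at h1
    refine le_trans ?_ h1.le
    rw [← Finset.sum_inter_add_sum_sdiff F s]
    have h2 : ∑ k ∈ F ∩ s, (‖z k‖ * A.a j k) ^ p = 0 :=
      Finset.sum_eq_zero fun k hk => by
        simp [hz k (Finset.mem_inter.1 hk).2, Real.zero_rpow h0]
    rw [h2, zero_add]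
    refine Finset.sum_le_sum fun k _ => ?_
    rcases hzy k with h | h
    · simpa [h, Real.zero_rpow h0] using hn k
    · rw [h]
  | czero =>
    obtain ⟨N, hN⟩ := (Metric.tendsto_atTop.1 (hy j)) ε hε
    refine ⟨Finset.range N, fun z hz hzy k => ?_⟩
    by_cases hk : k < N
    · simpa [hz k (Finset.mem_range.2 hk)] using hε.le
    · rcases hzy k with h | h
      · simpa [h] using hε.le
      · have := hN k (not_lt.1 hk)
        rw [Real.dist_eq, sub_zero, abs_of_nonneg (A.term_nonneg j k _)] at this
        rw [h]; exact this.le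

end KotheBound

/-! ### Completeness, the unit basis and continuity estimates -/

namespace KotheSpace

variable {κ : KotheKind} {A : KotheMatrix}

@[ext]
lemma ext {x y : KotheSpace 𝕜 κ A} (h : ∀ k, x.coord k = y.coord k) : x = y :=
  Subtype.ext (funext h)

@[simp] lemma coord_add (x y : KotheSpace 𝕜 κ A) : (x + y).coord = x.coord + y.coord := rfl

@[simp] lemma coord_sub (x y : KotheSpace 𝕜 κ A) : (x - y).coord = x.coord - y.coord := rfl

@[simp] lemma coord_smul (c : 𝕜) (x : KotheSpace 𝕜 κ A) : (c • x).coord = c • x.coord := rfl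

@[simp] lemma coord_zero : (0 : KotheSpace 𝕜 κ A).coord = 0 := rfl

@[simp] lemma coord_e (n : ℕ) : (e 𝕜 κ A n).coord = Pi.single n 1 := rfl

lemma isKothe_coord (x : KotheSpace 𝕜 κ A) : IsKothe κ A x.coord := x.2

/-- The element of the Köthe space with given coordinates. -/
def mk (x : ℕ → 𝕜) (hx : IsKothe κ A x) : KotheSpace 𝕜 κ A :=
  (⟨x, hx⟩ : ↥(kotheSubmodule 𝕜 κ A))

@[simp] lemma coord_mk (x : ℕ → 𝕜) (hx : IsKothe κ A x) : (mk x hx).coord = x := rfl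

variable (𝕜 κ A) in
/-- The coordinates as a linear map. -/
def coordₗ : KotheSpace 𝕜 κ A →ₗ[𝕜] ℕ → 𝕜 where
  toFun := coord
  map_add' := coord_add
  map_smul' := coord_smul

@[simp] lemma coordₗ_apply (x : KotheSpace 𝕜 κ A) : coordₗ 𝕜 κ A x = x.coord := rfl

lemma coord_le (j : ℕ) (x : KotheSpace 𝕜 κ A) (k : ℕ) :
    ‖x.coord k‖ * A.a j k ≤ kotheSeminorm 𝕜 κ A j x :=
  (x.isKothe_coord.kotheBound j).coord_le (kotheNorm_nonneg _ _ _ _) k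

lemma seminorm_le {j : ℕ} {C : ℝ} (hC : 0 ≤ C) {x : KotheSpace 𝕜 κ A}
    (h : KotheBound κ A j C x.coord) : kotheSeminorm 𝕜 κ A j x ≤ C :=
  h.kotheNorm_le hC

lemma kotheBound_of_le {j : ℕ} {C : ℝ} {x : KotheSpace 𝕜 κ A}
    (h : kotheSeminorm 𝕜 κ A j x ≤ C) : KotheBound κ A j C x.coord :=
  (x.isKothe_coord.kotheBound j).mono (kotheNorm_nonneg _ _ _ _) h

lemma _root_.KotheMatrix.monotone (A : KotheMatrix) (k : ℕ) : Monotone fun j => A.a j k :=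
  monotone_nat_of_le_succ fun j => A.mono j k

lemma seminorm_monotone : Monotone (kotheSeminorm 𝕜 κ A) := by
  intro i j hij x
  have hx := x.isKothe_coord.kotheBound j
  refine seminorm_le (kotheNorm_nonneg κ A j x.coord) ?_
  have hm : ∀ k, ‖x.coord k‖ * A.a i k ≤ ‖x.coord k‖ * A.a j k := fun k =>
    mul_le_mul_of_nonneg_left (A.monotone k hij) (norm_nonneg _)
  cases κ with
  | lam p hp =>
    exact fun F => (Finset.sum_le_sum fun k _ =>
      Real.rpow_le_rpow (A.term_nonneg i k _) (hm k) (by linarith)).trans (hx F)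
  | czero => exact fun k => (hm k).trans (hx k)

@[simp] lemma seminorm_e (j n : ℕ) : kotheSeminorm 𝕜 κ A j (e 𝕜 κ A n) = A.a j n := by
  refine le_antisymm (seminorm_le (A.pos j n).le ?_) ?_
  · cases κ with
    | lam p hp =>
      have h0 : p ≠ 0 := by linarith
      intro F
      have h1 : ∀ k, (‖(e 𝕜 (.lam p hp) A n).coord k‖ * A.a j k) ^ p =
          if k = n then A.a j n ^ p else 0 := by
        intro k
        split_ifs with hk
        · simp [hk]
        · simp [hk, Real.zero_rpow h0]
      simp only [h1, Finset.sum_ite_eq']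
      split_ifs
      · exact le_rfl
      · exact Real.rpow_nonneg (A.pos j n).le p
    | czero =>
      intro k
      rcases eq_or_ne k n with rfl | hk
      · simp
      · simpa [hk] using (A.pos j n).le
  · simpa using coord_le j (e 𝕜 κ A n) n

lemma seminorm_zero_pos {x : KotheSpace 𝕜 κ A} (hx : x ≠ 0) : 0 < kotheSeminorm 𝕜 κ A 0 x := by
  obtain ⟨k, hk⟩ : ∃ k, x.coord k ≠ 0 := by
    by_contra! h
    exact hx (ext h)
  exact (mul_pos (norm_pos_iff.2 hk) (A.pos 0 k)).trans_le (coord_le 0 x k)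

instance : T2Space (KotheSpace 𝕜 κ A) := by
  have := (KotheSpace.withSeminorms (𝕜 := 𝕜) κ A).T1_of_separating
    fun x hx => ⟨0, (seminorm_zero_pos hx).ne'⟩
  infer_instance

instance : FirstCountableTopology (KotheSpace 𝕜 κ A) :=
  (KotheSpace.withSeminorms (𝕜 := 𝕜) κ A).firstCountableTopology

lemma continuous_seminorm (j : ℕ) : Continuous (kotheSeminorm 𝕜 κ A j) :=
  (KotheSpace.withSeminorms κ A).continuous_seminorm j

lemma continuous_coord (k : ℕ) : Continuous fun x : KotheSpace 𝕜 κ A => x.coord k := by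
  rw [continuous_iff_continuousAt]
  intro x
  rw [ContinuousAt, tendsto_iff_norm_sub_tendsto_zero]
  have h1 : Tendsto (fun y => kotheSeminorm 𝕜 κ A 0 (y - x) / A.a 0 k) (𝓝 x) (𝓝 0) := by
    have : Continuous fun y => kotheSeminorm 𝕜 κ A 0 (y - x) / A.a 0 k :=
      ((continuous_seminorm 0).comp (continuous_id.sub continuous_const)).div_const _
    simpa using this.tendsto x
  refine squeeze_zero (fun _ => norm_nonneg _) (fun y => ?_) h1
  rw [le_div_iff₀ (A.pos 0 k)]
  exact coord_le 0 (y - x) k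

/-- Köthe spaces are sequentially complete. -/
theorem exists_tendsto_of_cauchy (u : ℕ → KotheSpace 𝕜 κ A)
    (hu : ∀ j, ∀ ε > 0, ∃ N, ∀ m ≥ N, ∀ n ≥ N, kotheSeminorm 𝕜 κ A j (u m - u n) ≤ ε) :
    ∃ x, Tendsto u atTop (𝓝 x) := by
  have hc : ∀ k, ∃ c, Tendsto (fun n => (u n).coord k) atTop (𝓝 c) := by
    intro k
    refine cauchySeq_tendsto_of_complete (Metric.cauchySeq_iff.2 fun ε hε => ?_)
    have ha := A.pos 0 k
    obtain ⟨N, hN⟩ := hu 0 (ε / 2 * A.a 0 k) (by positivity)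
    refine ⟨N, fun m hm n hn => ?_⟩
    rw [dist_eq_norm]
    have h1 := (coord_le 0 (u m - u n) k).trans (hN m hm n hn)
    have h2 := le_of_mul_le_mul_right h1 ha
    rw [coord_sub, Pi.sub_apply] at h2
    linarith
  choose y hy using hc
  have hb : ∀ j, ∀ ε > 0, ∃ N, ∀ m ≥ N, KotheBound κ A j ε (y - (u m).coord) := by
    intro j ε hε
    obtain ⟨N, hN⟩ := hu j ε hε
    refine ⟨N, fun m hm => KotheBound.of_tendsto (u := fun n => (u n).coord - (u m).coord)
      (fun k => (hy k).sub_const _) ?_⟩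
    filter_upwards [eventually_ge_atTop N] with n hn
    simpa using kotheBound_of_le (hN n hn m hm)
  have hyK : IsKothe κ A y := IsKothe.of_approx fun j ε hε => by
    obtain ⟨N, hN⟩ := hb j ε hε
    exact ⟨(u N).coord, (u N).isKothe_coord, hN N le_rfl⟩
  refine ⟨mk y hyK, ((KotheSpace.withSeminorms κ A).tendsto_nhds_atTop _ _).2 fun j ε hε => ?_⟩
  obtain ⟨N, hN⟩ := hb j (ε / 2) (by positivity)
  refine ⟨N, fun n hn => ?_⟩
  have h1 : kotheSeminorm 𝕜 κ A j (mk y hyK - u n) ≤ ε / 2 :=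
    seminorm_le (half_pos hε).le (by simpa using hN n hn)
  rw [map_sub_rev]
  exact h1.trans_lt (half_lt_self hε)

lemma seminorm_sum_le {ι : Type*} (j : ℕ) (s : Finset ι) (f : ι → KotheSpace 𝕜 κ A) :
    kotheSeminorm 𝕜 κ A j (∑ i ∈ s, f i) ≤ ∑ i ∈ s, kotheSeminorm 𝕜 κ A j (f i) :=
  Finset.le_sum_of_subadditive _ (map_zero _).le (map_add_le_add _) s f

lemma seminorm_le_tsum {ι : Type*} {f : ι → KotheSpace 𝕜 κ A} {x : KotheSpace 𝕜 κ A}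
    (hf : HasSum f x) {j : ℕ} {g : ι → ℝ} (hg : Summable g)
    (hfg : ∀ i, kotheSeminorm 𝕜 κ A j (f i) ≤ g i) : kotheSeminorm 𝕜 κ A j x ≤ ∑' i, g i := by
  refine le_of_tendsto (((continuous_seminorm j).tendsto x).comp hf) (Eventually.of_forall ?_)
  intro s
  refine (seminorm_sum_le j s f).trans ((Finset.sum_le_sum fun i _ => hfg i).trans ?_)
  exact hg.sum_le_tsum s fun i _ => (apply_nonneg _ _).trans (hfg i)

/-- Absolutely convergent series converge in a Köthe space. -/
theorem summable_of_seminorm (f : ℕ → KotheSpace 𝕜 κ A)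
    (hf : ∀ j, Summable fun n => kotheSeminorm 𝕜 κ A j (f n)) : Summable f := by
  have hv : ∀ j, ∀ ε > 0, ∃ s : Finset ℕ, ∀ t, Disjoint t s →
      kotheSeminorm 𝕜 κ A j (∑ i ∈ t, f i) ≤ ε := by
    intro j ε hε
    obtain ⟨s, hs⟩ := summable_iff_vanishing_norm.1 (hf j) ε hε
    refine ⟨s, fun t ht => (seminorm_sum_le j t f).trans ?_⟩
    exact (le_abs_self _).trans (hs t ht).le
  -- Comparing initial segments with an arbitrary finite `F ⊇ s` serves twice: for the Cauchy
  -- property of the initial sums, and for unconditional convergence to their limit.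
  have hr : ∀ j, ∀ ε > 0, ∃ s : Finset ℕ, ∀ F, s ⊆ F → ∀ᶠ n in atTop,
      kotheSeminorm 𝕜 κ A j (∑ i ∈ Finset.range n, f i - ∑ i ∈ F, f i) ≤ ε := by
    intro j ε hε
    obtain ⟨s, hs⟩ := hv j ε hε
    refine ⟨s, fun F hF => ?_⟩
    filter_upwards [tendsto_finset_range.eventually_ge_atTop F] with n hn
    rw [← Finset.sum_sdiff_eq_sub hn]
    exact hs _ (Finset.disjoint_of_subset_right hF Finset.sdiff_disjoint)
  obtain ⟨x, hx⟩ := exists_tendsto_of_cauchy (fun n => ∑ i ∈ Finset.range n, f i) (by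
    intro j ε hε
    obtain ⟨s, hs⟩ := hr j (ε / 2) (half_pos hε)
    obtain ⟨N, hN⟩ := eventually_atTop.1 (hs s subset_rfl)
    refine ⟨N, fun m hm n hn => ?_⟩
    have h1 := hN m hm
    have h2 := hN n hn
    rw [map_sub_rev] at h2
    have h3 := map_add_le_add (kotheSeminorm 𝕜 κ A j)
      (∑ i ∈ Finset.range m, f i - ∑ i ∈ s, f i) (∑ i ∈ s, f i - ∑ i ∈ Finset.range n, f i)
    rw [sub_add_sub_cancel] at h3
    linarith)
  refine ⟨x, ((KotheSpace.withSeminorms κ A).tendsto_nhds _ _).2 fun j ε hε => ?_⟩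
  obtain ⟨s, hs⟩ := hr j (ε / 2) (half_pos hε)
  rw [SummationFilter.unconditional_filter]
  filter_upwards [eventually_ge_atTop s] with F hF
  rw [map_sub_rev]
  refine lt_of_le_of_lt (le_of_tendsto ?_ (hs F hF)) (half_lt_self hε)
  exact ((continuous_seminorm j).tendsto _).comp (hx.sub_const _)

theorem hasSum_coord_smul_e (x : KotheSpace 𝕜 κ A) :
    HasSum (fun k => x.coord k • e 𝕜 κ A k) x := by
  refine ((KotheSpace.withSeminorms κ A).tendsto_nhds _ _).2 fun j ε hε => ?_
  obtain ⟨s, hs⟩ := x.isKothe_coord.kotheBound_truncate j (half_pos hε)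
  rw [SummationFilter.unconditional_filter]
  filter_upwards [eventually_ge_atTop s] with F hF
  have hc : ∀ k, (∑ i ∈ F, x.coord i • e 𝕜 κ A i - x).coord k =
      if k ∈ F then 0 else - x.coord k := by
    intro k
    rw [← coordₗ_apply, map_sub, map_sum]
    simp [Finset.sum_apply, Pi.single_apply]
    split_ifs <;> simp
  refine (seminorm_le (half_pos hε).le (hs _ ?_ ?_)).trans_lt (half_lt_self hε)
  · intro k hk
    rw [hc, if_pos (hF hk)]
  · intro k
    rw [hc]
    split_ifs <;> simp

instance : TopologicalSpace.SeparableSpace (KotheSpace 𝕜 κ A) := by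
  have h : TopologicalSpace.IsSeparable
      (Submodule.span 𝕜 (Set.range (e 𝕜 κ A)) : Set (KotheSpace 𝕜 κ A)) :=
    (Set.countable_range _).isSeparable.span
  rw [← TopologicalSpace.isSeparable_univ_iff]
  refine h.closure.mono fun x _ => ?_
  refine mem_closure_of_tendsto (hasSum_coord_smul_e x) (Eventually.of_forall fun F => ?_)
  exact Submodule.sum_mem _ fun k _ => Submodule.smul_mem _ _ (Submodule.subset_span ⟨k, rfl⟩)

lemma linearIndependent_e : LinearIndependent 𝕜 (e 𝕜 κ A) := by
  refine LinearIndependent.of_comp (coordₗ 𝕜 κ A) ?_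
  exact Pi.linearIndependent_single_one ℕ 𝕜

/-- Continuity of an operator in terms of the norms `p_j`. -/
lemma exists_bound (T : KotheSpace 𝕜 κ A →L[𝕜] KotheSpace 𝕜 κ A) (j : ℕ) :
    ∃ m, ∃ C > 0, ∀ x, kotheSeminorm 𝕜 κ A j (T x) ≤ C * kotheSeminorm 𝕜 κ A m x := by
  obtain ⟨s, C, hC, h⟩ := Seminorm.bound_of_continuous (KotheSpace.withSeminorms (𝕜 := 𝕜) κ A)
    ((kotheSeminorm 𝕜 κ A j).comp T.toLinearMap) ((continuous_seminorm j).comp T.continuous)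
  refine ⟨s.sup id, C, NNReal.coe_pos.2 (pos_iff_ne_zero.2 hC), fun x => (h x).trans ?_⟩
  rw [smul_apply, NNReal.smul_def, smul_eq_mul]
  refine mul_le_mul_of_nonneg_left ?_ C.2
  refine Seminorm.finset_sup_apply_le (apply_nonneg _ _) fun i hi => ?_
  exact seminorm_monotone (Finset.le_sup (f := id) hi) x

end KotheSpace

/-! ### Selecting indices at which finitely many iterates are small -/

section Selection

variable {α : ℕ → ℕ → ℝ} {J : ℕ}

/-- Iterating `hcont` costs a larger row and constant at each step; maxima make one choice serve all
shifts up to `N`. -/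
lemma exists_uniform_shift_bound (hpos : ∀ j k, 0 < α j k) (hmono : ∀ k, Monotone fun j => α j k)
    (hcont : ∀ j, ∃ j', ∃ C > 0, ∀ k, α j k ≤ C * α j' (k + 1)) (N : ℕ) :
    ∀ j, ∃ j', ∃ C > 0, ∀ i ≤ N, ∀ k, α j k ≤ C * α j' (k + i) := by
  induction N with
  | zero =>
    refine fun j => ⟨j, 1, one_pos, fun i hi k => ?_⟩
    simp [Nat.le_zero.1 hi]
  | succ N ih =>
    intro j
    obtain ⟨j₀, C₀, hC₀, h₀⟩ := hcont j
    obtain ⟨j₁, C₁, hC₁, h₁⟩ := ih j₀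
    refine ⟨max j j₁, max 1 (C₀ * C₁), by positivity, fun i hi k => ?_⟩
    cases i with
    | zero =>
      calc α j k ≤ 1 * α (max j j₁) k := by simpa using hmono k (le_max_left j j₁)
        _ ≤ _ := mul_le_mul_of_nonneg_right (le_max_left _ _) (hpos _ _).le
    | succ i =>
      calc α j k ≤ C₀ * α j₀ (k + 1) := h₀ k
        _ ≤ C₀ * (C₁ * α j₁ (k + 1 + i)) :=
          mul_le_mul_of_nonneg_left (h₁ i (by omega) _) hC₀.le
        _ = C₀ * C₁ * α j₁ (k + (i + 1)) := by rw [mul_assoc, add_assoc, add_comm 1 i]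
        _ ≤ _ := mul_le_mul (le_max_right _ _) (hmono _ (le_max_right _ _)) (hpos _ _).le
          (by positivity)

/-- Each step descends by at least `1` and at most `N`, at the price of a factor `ε`. A descent
already beyond `t` is kept; one of length exactly `t` is continued once, so the overshoot never
exceeds `N`. -/
lemma exists_chain {N : ℕ} {ε : ℝ} (hε0 : 0 ≤ ε) (hε1 : ε ≤ 1) (hpos : ∀ j k, 0 < α j k)
    (h : ∀ᶠ k in atTop, ∃ i, 1 ≤ i ∧ i ≤ N ∧ ε * α J k ≤ α J (k - i)) (t : ℕ) :
    ∀ᶠ q in atTop, ∃ S, t ≤ S ∧ S ≤ t + N ∧ ε ^ t * α J q ≤ α J (q - S) := by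
  induction t with
  | zero => exact Eventually.of_forall fun q => ⟨0, by simp⟩
  | succ t ih =>
    filter_upwards [ih, (tendsto_sub_atTop_nat t).eventually h] with q hq hqt
    obtain ⟨S, h1, h2, h3⟩ := hq
    rcases h1.lt_or_eq with h1 | rfl
    · refine ⟨S, h1, by omega, le_trans ?_ h3⟩
      exact mul_le_mul_of_nonneg_right (pow_le_pow_of_le_one hε0 hε1 (Nat.le_succ t)) (hpos _ _).le
    · obtain ⟨i, hi1, hiN, hi⟩ := hqt
      refine ⟨t + i, by omega, by omega, ?_⟩
      rw [← Nat.sub_sub]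
      refine le_trans ?_ hi
      rw [pow_succ', mul_assoc]
      exact mul_le_mul_of_nonneg_left h3 hε0

/-- If single iterates can be made small along some indices, then so can finitely many iterates
simultaneously. -/
theorem exists_frequently_forall_le (hpos : ∀ j k, 0 < α j k)
    (hmono : ∀ k, Monotone fun j => α j k)
    (hcont : ∀ j, ∃ j', ∃ C > 0, ∀ k, α j k ≤ C * α j' (k + 1))
    (ha : ∀ m j, ∃ m', ∃ C > 0, ∀ n, ∀ᶠ k in atTop,
      α j k * α m (n + k) ≤ C * (α J k * α m' (n + k)))
    (hb : ∃ m, ∀ n, 1 ≤ n → ∀ ε > 0, ∃ᶠ k in atTop, α J k ≤ ε * α m (n + k)) :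
    ∃ m, ∀ N, ∀ ε > 0, ∃ᶠ k in atTop, ∀ i, 1 ≤ i → i ≤ N → α J (k - i) ≤ ε * α m k := by
  by_contra hfail
  have hfail' : ∀ m, ∃ N, ∃ ε > 0, ε ≤ 1 ∧ ∀ᶠ k in atTop,
      ∃ i, 1 ≤ i ∧ i ≤ N ∧ ε * α m k ≤ α J (k - i) := by
    intro m
    have hm := hfail
    push Not at hm
    obtain ⟨N, ε, hε, h⟩ := hm m
    -- Taking `ε ≤ 1` makes its powers decrease, as the chaining requires.
    refine ⟨N, min ε 1, by positivity, min_le_right _ _, ?_⟩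
    filter_upwards [h] with k hk
    obtain ⟨i, h1, h2, h3⟩ := hk
    exact ⟨i, h1, h2,
      (mul_le_mul_of_nonneg_right (min_le_left _ _) (hpos _ _).le).trans h3.le⟩
  obtain ⟨m₀, hb⟩ := hb
  -- The order of choices matters: `N₁` bounds the overshoot of chains, `J₁` absorbs it, `m₂` comes
  -- from (a) for `J₁`, and only then does `N₂` become the fixed shift at which (b) is contradicted.
  obtain ⟨N₁, ε₁, hε₁, hε₁', h₁⟩ := hfail' (max m₀ J)
  obtain ⟨J₁, C₁, hC₁, hJ₁⟩ := exists_uniform_shift_bound hpos hmono hcont N₁ J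
  obtain ⟨m₂, C₂, hC₂, hm₂⟩ := ha (max m₀ J) J₁
  obtain ⟨N₂, ε₂, hε₂, -, h₂⟩ := hfail' m₂
  have hN₂ : 1 ≤ N₂ := by
    obtain ⟨k, i, h1, h2, -⟩ := h₂.exists
    omega
  have hch := exists_chain (α := α) (J := J) (N := N₁) hε₁.le hε₁' hpos (by
    filter_upwards [h₁] with k hk
    obtain ⟨i, h1, h2, h3⟩ := hk
    exact ⟨i, h1, h2,
      (mul_le_mul_of_nonneg_left (hmono k (le_max_right m₀ J)) hε₁.le).trans h3⟩)
  -- The first descent starts in row `m₂` and has an uncontrolled length `i ≤ N₂`; a chain in row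
  -- `J` prolongs it past `N₂`.
  have hlow : ∀ᶠ k in atTop, ∃ S, N₂ ≤ S ∧ S ≤ N₂ + N₁ ∧
      ε₁ ^ N₂ * (ε₂ * α m₂ k) ≤ α J (k - S) := by
    have hall : ∀ᶠ k in atTop, ∀ i ∈ Finset.range (N₂ + 1),
        ∃ S, N₂ - i ≤ S ∧ S ≤ N₂ - i + N₁ ∧ ε₁ ^ (N₂ - i) * α J (k - i) ≤ α J (k - i - S) :=
      (Finset.eventually_all _).2 fun i _ => (tendsto_sub_atTop_nat i).eventually (hch (N₂ - i))
    filter_upwards [h₂, hall] with k hk hk'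
    obtain ⟨i, h1, h2, h3⟩ := hk
    obtain ⟨S, hS1, hS2, hS⟩ := hk' i (Finset.mem_range.2 (by omega))
    refine ⟨i + S, by omega, by omega, ?_⟩
    rw [← Nat.sub_sub]
    refine le_trans ?_ hS
    refine mul_le_mul (pow_le_pow_of_le_one hε₁.le hε₁' (Nat.sub_le _ _)) h3
      (mul_pos hε₂ (hpos _ _)).le (by positivity)
  have hbig : ∀ᶠ k in atTop,
      ε₁ ^ N₂ * ε₂ / (C₁ * C₂) * α (max m₀ J) (N₂ + k) ≤ α J k := by
    filter_upwards [(tendsto_add_atTop_nat N₂).eventually hlow, hm₂ N₂,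
      eventually_ge_atTop N₁] with k hk hk' hkN
    obtain ⟨S, hS1, hS2, hS⟩ := hk
    -- Climbing back by `S - N₂ ≤ N₁` lands exactly at `k`, so the total shift is `N₂` whatever `S`
    -- was.
    have h3 : α J (k + N₂ - S) ≤ C₁ * α J₁ k := by
      have := hJ₁ (S - N₂) (by omega) (k + N₂ - S)
      rwa [show k + N₂ - S + (S - N₂) = k by omega] at this
    rw [add_comm k N₂] at hS h3
    have hm2 := hpos m₂ (N₂ + k)
    have hm1 := hpos (max m₀ J) (N₂ + k)
    rw [div_mul_eq_mul_div, div_le_iff₀ (by positivity)]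
    refine le_of_mul_le_mul_right ?_ hm2
    calc ε₁ ^ N₂ * ε₂ * α (max m₀ J) (N₂ + k) * α m₂ (N₂ + k)
        = ε₁ ^ N₂ * (ε₂ * α m₂ (N₂ + k)) * α (max m₀ J) (N₂ + k) := by ring
      _ ≤ C₁ * α J₁ k * α (max m₀ J) (N₂ + k) :=
        mul_le_mul_of_nonneg_right (hS.trans h3) hm1.le
      _ = C₁ * (α J₁ k * α (max m₀ J) (N₂ + k)) := by ring
      _ ≤ C₁ * (C₂ * (α J k * α m₂ (N₂ + k))) := mul_le_mul_of_nonneg_left hk' hC₁.le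
      _ = α J k * (C₁ * C₂) * α m₂ (N₂ + k) := by ring
  have hc : 0 < ε₁ ^ N₂ * ε₂ / (C₁ * C₂) := by positivity
  obtain ⟨k, hk1, hk2⟩ := ((hb N₂ hN₂ _ (half_pos hc)).and_eventually hbig).exists
  have hm1 := hpos (max m₀ J) (N₂ + k)
  have h4 : α J k ≤ ε₁ ^ N₂ * ε₂ / (C₁ * C₂) / 2 * α (max m₀ J) (N₂ + k) :=
    hk1.trans (mul_le_mul_of_nonneg_left (hmono _ (le_max_left _ _)) (half_pos hc).le)
  have h5 := mul_pos hc hm1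
  rw [div_mul_eq_mul_div _ (2 : ℝ)] at h4
  linarith

/-- The simultaneous estimate for the `j`-th norms, `j ≤ N`, of the first `N` iterates. The
set `I` of admissible iterates contains `0` only if the iterate `0` can be made small. -/
theorem exists_frequently_forall_forall_le (hpos : ∀ j k, 0 < α j k)
    (hmono : ∀ k, Monotone fun j => α j k)
    (hcont : ∀ j, ∃ j', ∃ C > 0, ∀ k, α j k ≤ C * α j' (k + 1))
    (ha : ∀ m j, ∃ m', ∃ C > 0, ∀ n, ∀ᶠ k in atTop,
      α j k * α m (n + k) ≤ C * (α J k * α m' (n + k)))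
    (hb : ∃ m, ∀ n, 1 ≤ n → ∀ ε > 0, ∃ᶠ k in atTop, α J k ≤ ε * α m (n + k))
    (I : Set ℕ) (hI : 0 ∈ I → ∃ m, ∀ ε > 0, ∀ᶠ k in atTop, α J k ≤ ε * α m k) :
    ∃ μ : ℕ → ℕ, ∀ N, ∀ ε > 0, ∃ᶠ k in atTop, N ≤ k ∧
      ∀ i ∈ I, i ≤ N → ∀ j ≤ N, α j (k - i) ≤ ε * α (μ j) k := by
  obtain ⟨m, hm⟩ := exists_frequently_forall_le hpos hmono hcont ha hb
  obtain ⟨m', hm'⟩ : ∃ m', 0 ∈ I → ∀ ε > 0, ∀ᶠ k in atTop, α J k ≤ ε * α m' k := by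
    by_cases h0 : 0 ∈ I
    · obtain ⟨m', h⟩ := hI h0
      exact ⟨m', fun _ => h⟩
    · exact ⟨0, fun h => absurd h h0⟩
  -- Hypothesis (a) trades row `J` at `k - i` for row `j`, replacing row `max m m'` at `k` by row `μ
  -- j`. Thus `μ` is fixed before `N` and `ε`.
  choose μ C hC hμ using ha (max m m')
  refine ⟨μ, fun N ε hε => ?_⟩
  obtain ⟨D, hD, hCD⟩ : ∃ D > 0, ∀ j ≤ N, C j ≤ D := by
    refine ⟨∑ j ∈ Finset.range (N + 1), C j,
      Finset.sum_pos (fun j _ => hC j) (by simp), fun j hj => ?_⟩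
    exact Finset.single_le_sum (fun i _ => (hC i).le) (Finset.mem_range.2 (by omega))
  have h1 := hm N (ε / D) (by positivity)
  have h2 : ∀ᶠ k in atTop, 0 ∈ I → α J k ≤ ε / D * α m' k := by
    by_cases h0 : 0 ∈ I
    · simpa [h0] using hm' h0 (ε / D) (by positivity)
    · simp [h0]
  have h3 : ∀ᶠ k in atTop, ∀ i ∈ Finset.range (N + 1), ∀ j ∈ Finset.range (N + 1),
      α j (k - i) * α (max m m') (i + (k - i)) ≤
        C j * (α J (k - i) * α (μ j) (i + (k - i))) :=
    (Finset.eventually_all _).2 fun i _ => (Finset.eventually_all _).2 fun j _ =>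
      (tendsto_sub_atTop_nat i).eventually (hμ j i)
  refine (h1.and_eventually (h2.and (h3.and (eventually_ge_atTop N)))).mono ?_
  rintro k ⟨hk1, hk2, hk3, hkN⟩
  refine ⟨hkN, fun i hiI hiN j hj => ?_⟩
  have h4 := hk3 i (Finset.mem_range.2 (by omega)) j (Finset.mem_range.2 (by omega))
  rw [show i + (k - i) = k by omega] at h4
  have hmm := hpos (max m m') k
  have h5 : α J (k - i) ≤ ε / D * α (max m m') k := by
    rcases Nat.eq_zero_or_pos i with rfl | hi
    · exact (hk2 hiI).trans
        (mul_le_mul_of_nonneg_left (hmono k (le_max_right m m')) (by positivity))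
    · exact (hk1 i hi hiN).trans
        (mul_le_mul_of_nonneg_left (hmono k (le_max_left m m')) (by positivity))
  have hμk := hpos (μ j) k
  refine le_of_mul_le_mul_right ?_ hmm
  calc α j (k - i) * α (max m m') k ≤ C j * (α J (k - i) * α (μ j) k) := h4
    _ ≤ D * (ε / D * α (max m m') k * α (μ j) k) :=
      mul_le_mul (hCD j hj) (mul_le_mul_of_nonneg_right h5 hμk.le)
        (mul_pos (hpos _ _) hμk).le hD.le
    _ = ε * α (μ j) k * α (max m m') k := by field_simp

end Selection

/-! ### Polynomials of weighted shifts on the unit sequences -/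

/-- The product of the moduli of the first `k` weights acting on `e k`. -/
def weightProd (w : ℕ → 𝕜) (k : ℕ) : ℝ := ∏ ν ∈ Finset.range k, ‖w (ν + 1)‖

namespace IsWeightedShift

variable {κ : KotheKind} {A : KotheMatrix} {w : ℕ → 𝕜}
  {B : KotheSpace 𝕜 κ A →L[𝕜] KotheSpace 𝕜 κ A}

lemma weightProd_pos (hB : IsWeightedShift w B) (k : ℕ) : 0 < weightProd w k :=
  Finset.prod_pos fun _ _ => norm_pos_iff.2 (hB.weight_ne_zero _)

lemma coord_pow_apply (hB : IsWeightedShift w B) (i : ℕ) (x : KotheSpace 𝕜 κ A) (k : ℕ) :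
    ((B ^ i) x).coord k = (∏ ν ∈ Finset.range i, w (k + (ν + 1))) * x.coord (k + i) := by
  induction i generalizing k with
  | zero => simp
  | succ i ih =>
    rw [pow_succ', mul_apply_eq_comp, hB.coord_apply, ih, Finset.prod_range_succ']
    have h1 : ∀ ν, k + 1 + (ν + 1) = k + (ν + 1 + 1) := fun ν => by ring
    simp only [h1, show k + 1 + i = k + (i + 1) by ring, zero_add]
    ring

lemma pow_apply_e (hB : IsWeightedShift w B) (i k : ℕ) :
    (B ^ i) (KotheSpace.e 𝕜 κ A (k + i)) =
      (∏ ν ∈ Finset.range i, w (k + (ν + 1))) • KotheSpace.e 𝕜 κ A k := by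
  ext l
  rw [hB.coord_pow_apply]
  rcases eq_or_ne l k with rfl | h
  · simp
  · simp [h]

/-- The weights met between `k - i` and `k` form a quotient of two values of `weightProd`; this
separates the variables and reduces the weighted shift to the matrix `α`. -/
lemma seminorm_pow_apply_e (hB : IsWeightedShift w B) (j : ℕ) {i k : ℕ} (hik : i ≤ k) :
    kotheSeminorm 𝕜 κ A j ((B ^ i) (KotheSpace.e 𝕜 κ A k)) =
      weightProd w k * (A.a j (k - i) / weightProd w (k - i)) := by
  obtain ⟨l, rfl⟩ := Nat.exists_eq_add_of_le' hik
  rw [hB.pow_apply_e, map_smul_eq_mul, KotheSpace.seminorm_e, Nat.add_sub_cancel]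
  have h := hB.weightProd_pos l
  have h1 : weightProd w (l + i) =
      weightProd w l * ∏ ν ∈ Finset.range i, ‖w (l + (ν + 1))‖ := by
    simp only [weightProd, Finset.prod_range_add, add_assoc]
  rw [h1, norm_prod]
  field_simp

/-- Continuity of `B`, tested on unit sequences, provides the hypothesis `hcont` of the selection
results. -/
lemma exists_weighted_bound (hB : IsWeightedShift w B) (j : ℕ) :
    ∃ m, ∃ C > 0, ∀ k, A.a j k / weightProd w k ≤
      C * (A.a m (k + 1) / weightProd w (k + 1)) := by
  obtain ⟨m, C, hC, h⟩ := KotheSpace.exists_bound B j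
  refine ⟨m, C, hC, fun k => ?_⟩
  have h1 := h (KotheSpace.e 𝕜 κ A (k + 1))
  have h2 := hB.seminorm_pow_apply_e j (i := 1) (k := k + 1) (by omega)
  rw [pow_one, Nat.add_sub_cancel] at h2
  rw [h2, KotheSpace.seminorm_e] at h1
  have h3 := hB.weightProd_pos (k + 1)
  rw [mul_div_assoc', le_div_iff₀ h3]
  linarith

/-- Along suitable unit sequences the powers of a polynomial of the weighted shift are small
perturbations of multiples of the identity by scalars of modulus at most `1`. -/
theorem exists_frequently_seminorm_le (hB : IsWeightedShift w B) (P : 𝕜[X]) (J : ℕ)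
    (ha : ∀ m j, ∃ m', ∃ C > 0, ∀ n, ∀ᶠ k in atTop,
      A.a j k * A.a m (n + k) ≤ C * (A.a J k * A.a m' (n + k)))
    (hb : ∃ m, ∀ n, 1 ≤ n → ∀ ε > 0, ∃ᶠ k in atTop,
      A.a J k / weightProd w k ≤ ε * (A.a m (n + k) / weightProd w (n + k)))
    (hc : ‖P.coeff 0‖ ≤ 1 ∨ ∃ m, Tendsto (fun k => A.a J k / A.a m k) atTop (𝓝 0)) :
    ∃ c : ℕ → 𝕜, (∀ n, ‖c n‖ ≤ 1) ∧ ∃ μ : ℕ → ℕ, ∀ N, ∀ ε > 0, ∃ᶠ k in atTop,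
      ∀ n ≤ N, ∀ j ≤ N, kotheSeminorm 𝕜 κ A j
        ((aeval B P ^ n) (KotheSpace.e 𝕜 κ A k) - c n • KotheSpace.e 𝕜 κ A k) ≤
          ε * A.a (μ j) k := by
  have hω := hB.weightProd_pos
  have hpos : ∀ j k, 0 < A.a j k / weightProd w k := fun j k => div_pos (A.pos j k) (hω k)
  obtain ⟨μ, hμ⟩ := exists_frequently_forall_forall_le (J := J)
    (α := fun j k => A.a j k / weightProd w k) hpos
    (fun k i j hij => div_le_div_of_nonneg_right (A.monotone k hij) (hω k).le)
    hB.exists_weighted_bound (by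
      intro m j
      obtain ⟨m', C, hC, h⟩ := ha m j
      refine ⟨m', C, hC, fun n => (h n).mono fun k hk => ?_⟩
      -- Both sides of (a) involve the same two columns, so renormalising columns leaves it
      -- unchanged.
      rw [div_mul_div_comm, div_mul_div_comm, mul_div_assoc']
      exact div_le_div_of_nonneg_right hk (mul_pos (hω _) (hω _)).le)
    hb {i | 1 ≤ i ∨ ¬ ‖P.coeff 0‖ ≤ 1} (by
      intro h0
      have h0' : ¬ ‖P.coeff 0‖ ≤ 1 := by simpa using h0
      obtain ⟨m, hm⟩ := hc.resolve_left h0'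
      refine ⟨m, fun ε hε => ?_⟩
      filter_upwards [hm.eventually_le_const hε] with k hk
      rw [div_le_iff₀ (A.pos m k)] at hk
      rw [mul_div_assoc']
      exact div_le_div_of_nonneg_right hk (hω k).le)
  -- If `|P(0)| ≤ 1`, taking `c n = P(0)^n` removes the constant term of `P^n - c n`, so the iterate
  -- `0` is never needed. Otherwise `c = 0`, and (c) makes the iterate `0` small as well.
  obtain ⟨c, hc1, hc0⟩ : ∃ c : ℕ → 𝕜, (∀ n, ‖c n‖ ≤ 1) ∧
      (‖P.coeff 0‖ ≤ 1 → ∀ n, c n = P.coeff 0 ^ n) := by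
    by_cases h : ‖P.coeff 0‖ ≤ 1
    · refine ⟨fun n => P.coeff 0 ^ n, fun n => ?_, fun _ _ => rfl⟩
      rw [norm_pow]
      exact pow_le_one₀ (norm_nonneg _) h
    · exact ⟨0, fun n => by simp, fun h' => absurd h' h⟩
  refine ⟨c, hc1, μ, fun N ε hε => ?_⟩
  set Q : ℕ → 𝕜[X] := fun n => P ^ n - C (c n) with hQ
  have hQ0 : ∀ n, ‖P.coeff 0‖ ≤ 1 → (Q n).coeff 0 = 0 := by
    intro n h
    simp [hQ, hc0 h, coeff_zero_eq_eval_zero]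
  set L : ℕ → ℝ := fun n => ∑ i ∈ Finset.range ((Q n).natDegree + 1), ‖(Q n).coeff i‖ with hL
  have hL0 : ∀ n, 0 ≤ L n := fun n => Finset.sum_nonneg fun i _ => norm_nonneg _
  set S : ℝ := 1 + ∑ n ∈ Finset.range (N + 1), L n with hS
  have hS0 : 0 < S := by
    have := Finset.sum_nonneg fun n (_ : n ∈ Finset.range (N + 1)) => hL0 n
    linarith
  refine (hμ (N + ∑ n ∈ Finset.range (N + 1), (Q n).natDegree) (ε / S) (by positivity)).mono ?_
  rintro k ⟨hkN, hk⟩ n hn j hj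
  have hnm : n ∈ Finset.range (N + 1) := Finset.mem_range.2 (by omega)
  have hdeg : (Q n).natDegree ≤ ∑ n ∈ Finset.range (N + 1), (Q n).natDegree :=
    Finset.single_le_sum (f := fun n => (Q n).natDegree) (fun _ _ => Nat.zero_le _) hnm
  have hLS : L n ≤ S := by
    have := Finset.single_le_sum (fun i _ => hL0 i) hnm
    linarith
  have hexp : (aeval B P ^ n) (KotheSpace.e 𝕜 κ A k) -
      c n • KotheSpace.e 𝕜 κ A k =
      ∑ i ∈ Finset.range ((Q n).natDegree + 1),
        (Q n).coeff i • (B ^ i) (KotheSpace.e 𝕜 κ A k) := by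
    have h1 : aeval B (Q n) = aeval B P ^ n -
        algebraMap 𝕜 _ (c n) := by
      simp only [hQ, map_sub, map_pow, aeval_C]
    have h2 := congrArg (fun R => R (KotheSpace.e 𝕜 κ A k)) (h1.symm.trans (aeval_eq_sum_range B))
    simpa [Algebra.algebraMap_eq_smul_one] using h2
  rw [hexp]
  refine (KotheSpace.seminorm_sum_le _ _ _).trans ?_
  have hterm : ∀ i ∈ Finset.range ((Q n).natDegree + 1),
      kotheSeminorm 𝕜 κ A j ((Q n).coeff i • (B ^ i) (KotheSpace.e 𝕜 κ A k)) ≤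
        ‖(Q n).coeff i‖ * (ε / S * A.a (μ j) k) := by
    intro i hi
    rw [Finset.mem_range] at hi
    rw [map_smul_eq_mul]
    by_cases hiI : 1 ≤ i ∨ ¬ ‖P.coeff 0‖ ≤ 1
    · refine mul_le_mul_of_nonneg_left ?_ (norm_nonneg _)
      have h3 := hk i hiI (by omega) j (by omega)
      rw [hB.seminorm_pow_apply_e j (by omega)]
      refine (mul_le_mul_of_nonneg_left h3 (hω k).le).trans_eq ?_
      have := (hω k).ne'
      field_simp
    · push Not at hiI
      obtain rfl : i = 0 := by omega
      simp [hQ0 n hiI.2]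
  refine (Finset.sum_le_sum hterm).trans ?_
  rw [← Finset.sum_mul]
  calc L n * (ε / S * A.a (μ j) k) ≤ S * (ε / S * A.a (μ j) k) :=
        mul_le_mul_of_nonneg_right hLS (mul_pos (by positivity) (A.pos _ _)).le
    _ = ε * A.a (μ j) k := by field_simp

end IsWeightedShift

/-! ### Construction of hypercyclic subspaces -/

/-- Sequences can be constructed by strong recursion from a relation between the past of the
sequence and its next term. -/
theorem exists_seq_of_strong_rec {D : Type*} [Nonempty D] (R : ℕ → (ℕ → D) → D → Prop)
    (hR : ∀ s f g d, (∀ i < s, f i = g i) → R s f d → R s g d)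
    (h : ∀ s f, (∀ i < s, R i f (f i)) → ∃ d, R s f d) : ∃ f : ℕ → D, ∀ s, R s f (f s) := by
  classical
  let d₀ : D := Classical.arbitrary D
  let G : ∀ s, (∀ i, i < s → D) → D := fun s prev =>
    Classical.epsilon (R s fun i => if hi : i < s then prev i hi else d₀)
  let f : ℕ → D := Nat.lt_wfRel.wf.fix G
  have hf : ∀ s, f s = G s fun i _ => f i := fun s => Nat.lt_wfRel.wf.fix_eq G s
  refine ⟨f, fun s => ?_⟩
  induction s using Nat.strong_induction_on with
  | _ s ih =>
    obtain ⟨d, hd⟩ := h s f ih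
    -- The recursion sees only the past of `f`, padded with `d₀`; `hR` says that the padding is
    -- irrelevant.
    have h1 : ∃ d, R s (fun i => if hi : i < s then f i else d₀) d :=
      ⟨d, hR s f _ d (fun i hi => by simp [hi]) hd⟩
    have h2 := Classical.epsilon_spec h1
    rw [hf s]
    exact hR s _ f _ (fun i hi => by simp [hi]) h2

/-! ### Stages of the inductive choice -/

namespace KotheSpace

variable {κ : KotheKind} {A : KotheMatrix}

lemma mem_closure_of_seminorm {S : Set (KotheSpace 𝕜 κ A)} {y : KotheSpace 𝕜 κ A}
    (h : ∀ j, ∀ ε > 0, ∃ x ∈ S, kotheSeminorm 𝕜 κ A j (x - y) < ε) : y ∈ closure S := by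
  choose x hxS hx using fun j : ℕ => h j ((1 / 2) ^ j) (by positivity)
  refine mem_closure_of_tendsto (f := x) (b := atTop) ?_ (Eventually.of_forall hxS)
  refine ((KotheSpace.withSeminorms κ A).tendsto_nhds _ _).2 fun j ε hε => ?_
  filter_upwards [eventually_ge_atTop j, (tendsto_pow_atTop_nhds_zero_of_lt_one
    (by norm_num : (0 : ℝ) ≤ 1 / 2) (by norm_num)).eventually_lt_const hε] with n hn hn'
  exact (seminorm_monotone hn _).trans_lt ((hx n).trans hn')

lemma eventually_seminorm_lt {ι : Type*} {l : Filter ι} {u : ι → KotheSpace 𝕜 κ A}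
    {x : KotheSpace 𝕜 κ A} (hu : Tendsto u l (𝓝 x)) (j : ℕ) {ε : ℝ}
    (hε : kotheSeminorm 𝕜 κ A j x < ε) : ∀ᶠ i in l, kotheSeminorm 𝕜 κ A j (u i) < ε :=
  (((continuous_seminorm j).tendsto x).comp hu).eventually_lt_const hε

lemma _root_.eventually_forall_lt {ι : Type*} {l : Filter ι} {p : ι → ℕ → Prop} {s : ℕ}
    (h : ∀ i < s, ∀ᶠ a in l, p a i) : ∀ᶠ a in l, ∀ i < s, p a i := by
  simpa using (Finset.eventually_all (Finset.range s)).2 fun i hi => h i (Finset.mem_range.1 hi)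

variable (𝕜 κ A) in
/-- The unit sequence `e k`, normalized for the norm with index `0`. -/
def unit (k : ℕ) : KotheSpace 𝕜 κ A := (((A.a 0 k)⁻¹ : ℝ) : 𝕜) • e 𝕜 κ A k

variable (𝕜 κ A) in
/-- The data chosen at one stage of the construction: an exponent, a vector that is mapped
close to a prescribed target, an index of a unit sequence, and an approximation of it. -/
structure Stage where
  n : ℕ
  z : KotheSpace 𝕜 κ A
  k : ℕ
  v : KotheSpace 𝕜 κ A

instance : Nonempty (Stage 𝕜 κ A) := ⟨⟨0, 0, 0, 0⟩⟩

/-- The requirements on the data `d` of stage `s`, given the data `f i` for `i < s`. -/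
structure Stage.Valid (T : KotheSpace 𝕜 κ A →L[𝕜] KotheSpace 𝕜 κ A) (c : ℕ → 𝕜) (μ : ℕ → ℕ)
    (X₀ : Set (KotheSpace 𝕜 κ A)) (y : ℕ → KotheSpace 𝕜 κ A) (s : ℕ) (f : ℕ → Stage 𝕜 κ A)
    (d : Stage 𝕜 κ A) : Prop where
  one_le_n : 1 ≤ d.n
  z_mem : d.z ∈ X₀
  v_mem : d.v ∈ X₀
  k_lt : ∀ i < s, (f i).k < d.k
  old_v : ∀ i < s, kotheSeminorm 𝕜 κ A s ((T ^ d.n) (f i).v) ≤ (1 / 2) ^ (s + i)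
  old_z : ∀ i < s, kotheSeminorm 𝕜 κ A s ((T ^ d.n) (f i).z) ≤ (1 / 2) ^ (s + i)
  -- The extra `4`, here and in `v_le`, keeps the total perturbation in the norm `0` below `1 / 2`.
  z_le : kotheSeminorm 𝕜 κ A s d.z ≤ (1 / 2) ^ (s + 4)
  z_new : ∀ i < s, kotheSeminorm 𝕜 κ A s ((T ^ (f i).n) d.z) ≤ (1 / 2) ^ (i + s)
  z_target : kotheSeminorm 𝕜 κ A s ((T ^ d.n) d.z - y s) ≤ (1 / 2) ^ (s + s)
  e_le : ∀ n, (n = d.n ∨ ∃ i < s, n = (f i).n) → ∀ j ≤ s, kotheSeminorm 𝕜 κ A j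
    ((T ^ n) (e 𝕜 κ A d.k) - c n • e 𝕜 κ A d.k) ≤ (1 / 2) ^ (s + s) * A.a (μ j) d.k
  v_le : kotheSeminorm 𝕜 κ A s (d.v - unit 𝕜 κ A d.k) ≤ (1 / 2) ^ (s + 4)
  v_new : ∀ n, (n = d.n ∨ ∃ i < s, n = (f i).n) →
    kotheSeminorm 𝕜 κ A s ((T ^ n) (d.v - unit 𝕜 κ A d.k)) ≤ (1 / 2) ^ (s + s)

variable {T : KotheSpace 𝕜 κ A →L[𝕜] KotheSpace 𝕜 κ A} {c : ℕ → 𝕜} {μ : ℕ → ℕ}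

lemma Stage.Valid.congr {X₀ : Set (KotheSpace 𝕜 κ A)} {y : ℕ → KotheSpace 𝕜 κ A} {s : ℕ}
    {f g : ℕ → Stage 𝕜 κ A} {d : Stage 𝕜 κ A} (hfg : ∀ i < s, f i = g i)
    (h : Valid T c μ X₀ y s f d) : Valid T c μ X₀ y s g d where
  one_le_n := h.one_le_n
  z_mem := h.z_mem
  v_mem := h.v_mem
  k_lt i hi := hfg i hi ▸ h.k_lt i hi
  old_v i hi := hfg i hi ▸ h.old_v i hi
  old_z i hi := hfg i hi ▸ h.old_z i hi
  z_le := h.z_le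
  z_new i hi := hfg i hi ▸ h.z_new i hi
  z_target := h.z_target
  e_le n hn := h.e_le n (hn.imp_right fun ⟨i, hi, hn⟩ => ⟨i, hi, hn.trans (by rw [hfg i hi])⟩)
  v_le := h.v_le
  v_new n hn := h.v_new n (hn.imp_right fun ⟨i, hi, hn⟩ => ⟨i, hi, hn.trans (by rw [hfg i hi])⟩)

/-- Under the Hypercyclicity Criterion each stage of the construction can be carried out. -/
theorem exists_stage {X₀ Y₀ : Set (KotheSpace 𝕜 κ A)} {n : ℕ → ℕ}
    {S : ℕ → KotheSpace 𝕜 κ A → KotheSpace 𝕜 κ A} (hX₀ : Dense X₀) (hY₀ : Dense Y₀)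
    (hn : StrictMono n) (hT : ∀ x ∈ X₀, Tendsto (fun k => (T ^ n k) x) atTop (𝓝 0))
    (hS : ∀ y ∈ Y₀, Tendsto (fun k => S k y) atTop (𝓝 0))
    (hTS : ∀ y ∈ Y₀, Tendsto (fun k => (T ^ n k) (S k y)) atTop (𝓝 y))
    (hμ : ∀ N, ∀ ε > 0, ∃ᶠ k in atTop, ∀ n ≤ N, ∀ j ≤ N, kotheSeminorm 𝕜 κ A j
      ((T ^ n) (e 𝕜 κ A k) - c n • e 𝕜 κ A k) ≤ ε * A.a (μ j) k)
    (y : ℕ → KotheSpace 𝕜 κ A) (s : ℕ) (f : ℕ → Stage 𝕜 κ A)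
    (hf : ∀ i < s, Stage.Valid T c μ X₀ y i f (f i)) : ∃ d, Stage.Valid T c μ X₀ y s f d := by
  have hhalf : ∀ i : ℕ, (0 : ℝ) < (1 / 2) ^ i := fun i => by positivity
  obtain ⟨y₀, hy₀, hyY⟩ : ∃ y₀, kotheSeminorm 𝕜 κ A s (y₀ - y s) < (1 / 2) ^ (s + s) ∧ y₀ ∈ Y₀ := by
    have h1 : Tendsto (fun z => z - y s) (𝓝 (y s)) (𝓝 0) := by
      simpa using (tendsto_id (x := 𝓝 (y s))).sub_const (y s)
    have h2 := eventually_seminorm_lt h1 s (ε := (1 / 2) ^ (s + s)) (by simp)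
    exact (h2.and_frequently (mem_closure_iff_frequently.1 (hY₀ (y s)))).exists
  have e1 : ∀ᶠ k in atTop, 1 ≤ n k :=
    (eventually_ge_atTop 1).mono fun k hk => hk.trans (hn.id_le k)
  have e2 : ∀ᶠ k in atTop, ∀ i < s,
      kotheSeminorm 𝕜 κ A s ((T ^ n k) (f i).v) < (1 / 2) ^ (s + i) :=
    eventually_forall_lt fun i hi => eventually_seminorm_lt (hT _ (hf i hi).v_mem) s (by simp)
  have e3 : ∀ᶠ k in atTop, ∀ i < s,
      kotheSeminorm 𝕜 κ A s ((T ^ n k) (f i).z) < (1 / 2) ^ (s + i) :=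
    eventually_forall_lt fun i hi => eventually_seminorm_lt (hT _ (hf i hi).z_mem) s (by simp)
  have e4 : ∀ᶠ k in atTop, kotheSeminorm 𝕜 κ A s (S k y₀) < (1 / 2) ^ (s + 4) :=
    eventually_seminorm_lt (hS y₀ hyY) s (by simp)
  have e5 : ∀ᶠ k in atTop, ∀ i < s,
      kotheSeminorm 𝕜 κ A s ((T ^ (f i).n) (S k y₀)) < (1 / 2) ^ (i + s) :=
    eventually_forall_lt fun i hi => eventually_seminorm_lt
      (((T ^ (f i).n).continuous.tendsto 0).comp (hS y₀ hyY)) s (by simp)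
  have e6 : ∀ᶠ k in atTop,
      kotheSeminorm 𝕜 κ A s ((T ^ n k) (S k y₀) - y s) < (1 / 2) ^ (s + s) :=
    eventually_seminorm_lt ((hTS y₀ hyY).sub_const (y s)) s hy₀
  obtain ⟨r, hr1, hr2, hr3, hr4, hr5, hr6⟩ :=
    (e1.and (e2.and (e3.and (e4.and (e5.and e6))))).exists
  have hz : ∀ᶠ z in 𝓝 (S r y₀), kotheSeminorm 𝕜 κ A s z < (1 / 2) ^ (s + 4) ∧
      (∀ i < s, kotheSeminorm 𝕜 κ A s ((T ^ (f i).n) z) < (1 / 2) ^ (i + s)) ∧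
      kotheSeminorm 𝕜 κ A s ((T ^ n r) z - y s) < (1 / 2) ^ (s + s) :=
    (eventually_seminorm_lt tendsto_id s hr4).and
      ((eventually_forall_lt fun i hi => eventually_seminorm_lt ((T ^ (f i).n).continuous.tendsto _) s
        (hr5 i hi)).and
      (eventually_seminorm_lt (((T ^ n r).continuous.tendsto _).sub_const _) s hr6))
  -- `S r y₀` need not lie in `X₀`; the requirements are open conditions, so a nearby point of `X₀`
  -- meets them.
  obtain ⟨z, ⟨hz1, hz2, hz3⟩, hzX⟩ :=
    (hz.and_frequently (mem_closure_iff_frequently.1 (hX₀ (S r y₀)))).exists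
  -- The exponent `n r` is fixed first, so one index `k` can serve all exponents chosen so far,
  -- which the sum dominates.
  obtain ⟨k, hk1, hk2⟩ := ((hμ (s + n r + ∑ i ∈ Finset.range s, (f i).n) _
    (hhalf (s + s))).and_eventually (eventually_forall_lt fun i _ => eventually_gt_atTop (f i).k)).exists
  have hle : ∀ m, (m = n r ∨ ∃ i < s, m = (f i).n) →
      m ≤ s + n r + ∑ i ∈ Finset.range s, (f i).n := by
    rintro m (rfl | ⟨i, hi, rfl⟩)
    · omega
    · have := Finset.single_le_sum (f := fun i => (f i).n) (fun _ _ => Nat.zero_le _)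
        (Finset.mem_range.2 hi)
      omega
  have hsub : Tendsto (fun v => v - unit 𝕜 κ A k) (𝓝 (unit 𝕜 κ A k)) (𝓝 0) := by
    simpa using (tendsto_id (x := 𝓝 (unit 𝕜 κ A k))).sub_const (unit 𝕜 κ A k)
  have hsubT : ∀ m, ∀ᶠ v in 𝓝 (unit 𝕜 κ A k),
      kotheSeminorm 𝕜 κ A s ((T ^ m) (v - unit 𝕜 κ A k)) < (1 / 2) ^ (s + s) := fun m =>
    eventually_seminorm_lt (((T ^ m).continuous.tendsto 0).comp hsub) s (by simp)
  have hv : ∀ᶠ v in 𝓝 (unit 𝕜 κ A k),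
      kotheSeminorm 𝕜 κ A s (v - unit 𝕜 κ A k) < (1 / 2) ^ (s + 4) ∧
      kotheSeminorm 𝕜 κ A s ((T ^ n r) (v - unit 𝕜 κ A k)) < (1 / 2) ^ (s + s) ∧
      ∀ i < s, kotheSeminorm 𝕜 κ A s ((T ^ (f i).n) (v - unit 𝕜 κ A k)) < (1 / 2) ^ (s + s) :=
    (eventually_seminorm_lt hsub s (by simp)).and
      ((hsubT _).and (eventually_forall_lt fun i _ => hsubT _))
  obtain ⟨v, ⟨hv1, hv2, hv3⟩, hvX⟩ :=
    (hv.and_frequently (mem_closure_iff_frequently.1 (hX₀ (unit 𝕜 κ A k)))).exists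
  exact ⟨⟨n r, z, k, v⟩,
    { one_le_n := hr1
      z_mem := hzX
      v_mem := hvX
      k_lt := hk2
      old_v := fun i hi => (hr2 i hi).le
      old_z := fun i hi => (hr3 i hi).le
      z_le := hz1.le
      z_new := fun i hi => (hz2 i hi).le
      z_target := hz3.le
      e_le := fun m hm j hj => hk1 m (hle m hm) j (by omega)
      v_le := hv1.le
      v_new := by
        rintro m (rfl | ⟨i, hi, rfl⟩)
        · exact hv2.le
        · exact (hv3 i hi).le }⟩

end KotheSpace

namespace KotheSpace

variable {κ : KotheKind} {A : KotheMatrix}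

/-! #### Small perturbations of the unit sequences -/

variable (𝕜 κ A) in
/-- The subspace of the sequences supported on the range of `K`. -/
def supported (K : ℕ → ℕ) : Submodule 𝕜 (KotheSpace 𝕜 κ A) where
  carrier := {x | ∀ k ∉ Set.range K, x.coord k = 0}
  zero_mem' := fun _ _ => rfl
  add_mem' := fun hx hy k hk => by simp [hx k hk, hy k hk]
  smul_mem' := fun c x hx k hk => by simp [hx k hk]

lemma e_mem_supported (K : ℕ → ℕ) (i : ℕ) : e 𝕜 κ A (K i) ∈ supported 𝕜 κ A K := by
  intro k hk
  have : k ≠ K i := fun h => hk ⟨i, h.symm⟩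
  simp [this]

lemma isClosed_supported (K : ℕ → ℕ) : IsClosed (supported 𝕜 κ A K : Set (KotheSpace 𝕜 κ A)) := by
  have : (supported 𝕜 κ A K : Set (KotheSpace 𝕜 κ A)) =
      ⋂ k ∈ (Set.range K)ᶜ, {x | x.coord k = 0} := by
    ext x
    simp [supported]
  rw [this]
  exact isClosed_biInter fun k _ => isClosed_eq (continuous_coord k) continuous_const

lemma hasSum_supported {K : ℕ → ℕ} (hK : StrictMono K) {x : KotheSpace 𝕜 κ A}
    (hx : x ∈ supported 𝕜 κ A K) : HasSum (fun i => x.coord (K i) • e 𝕜 κ A (K i)) x := by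
  refine (hK.injective.hasSum_iff (f := fun k => x.coord k • e 𝕜 κ A k) fun k hk => ?_).2
    (hasSum_coord_smul_e x)
  rw [hx k hk, zero_smul]

/-- The coefficient of `unit k` in the expansion of `x`. -/
def unitCoeff (k : ℕ) (x : KotheSpace 𝕜 κ A) : 𝕜 := x.coord k * (A.a 0 k : 𝕜)

lemma norm_unitCoeff_le (k : ℕ) (x : KotheSpace 𝕜 κ A) :
    ‖unitCoeff k x‖ ≤ kotheSeminorm 𝕜 κ A 0 x := by
  rw [unitCoeff, norm_mul, RCLike.norm_ofReal, abs_of_pos (A.pos 0 k)]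
  exact coord_le 0 x k

lemma unitCoeff_smul_unit (k : ℕ) (x : KotheSpace 𝕜 κ A) :
    unitCoeff k x • unit 𝕜 κ A k = x.coord k • e 𝕜 κ A k := by
  have h : (A.a 0 k : 𝕜) ≠ 0 := RCLike.ofReal_ne_zero.2 (A.pos 0 k).ne'
  rw [unitCoeff, unit, smul_smul, RCLike.ofReal_inv, mul_assoc, mul_inv_cancel₀ h, mul_one]

lemma unitCoeff_add (k : ℕ) (x y : KotheSpace 𝕜 κ A) :
    unitCoeff k (x + y) = unitCoeff k x + unitCoeff k y := by simp [unitCoeff, add_mul]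

lemma unitCoeff_smul (k : ℕ) (a : 𝕜) (x : KotheSpace 𝕜 κ A) :
    unitCoeff k (a • x) = a * unitCoeff k x := by simp [unitCoeff, mul_assoc]

section Perturbation

variable (K l : ℕ → ℕ) (δ z : ℕ → KotheSpace 𝕜 κ A)

/-- The terms of the perturbation series. -/
def perturbTerm (x : KotheSpace 𝕜 κ A) (i : ℕ) : KotheSpace 𝕜 κ A :=
  unitCoeff (K i) x • δ i + unitCoeff (K (l i)) x • z i

lemma seminorm_perturbTerm_le (j : ℕ) (x : KotheSpace 𝕜 κ A) (i : ℕ) :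
    kotheSeminorm 𝕜 κ A j (perturbTerm K l δ z x i) ≤
      kotheSeminorm 𝕜 κ A 0 x *
        (kotheSeminorm 𝕜 κ A j (δ i) + kotheSeminorm 𝕜 κ A j (z i)) := by
  refine (map_add_le_add _ _ _).trans ?_
  rw [map_smul_eq_mul, map_smul_eq_mul, mul_add]
  exact add_le_add
    (mul_le_mul_of_nonneg_right (norm_unitCoeff_le _ _) (apply_nonneg _ _))
    (mul_le_mul_of_nonneg_right (norm_unitCoeff_le _ _) (apply_nonneg _ _))

variable {δ z}
variable (hs : ∀ j, Summable fun i => kotheSeminorm 𝕜 κ A j (δ i) + kotheSeminorm 𝕜 κ A j (z i))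

include hs in
lemma summable_perturbTerm (x : KotheSpace 𝕜 κ A) : Summable (perturbTerm K l δ z x) :=
  summable_of_seminorm _ fun j => ((hs j).mul_left _).of_nonneg_of_le
    (fun _ => apply_nonneg _ _) (seminorm_perturbTerm_le K l δ z j x)

/-- The perturbed identity `x ↦ x + ∑ (a_i(x) δ_i + a_{l i}(x) z_i)`. -/
def perturb : KotheSpace 𝕜 κ A →ₗ[𝕜] KotheSpace 𝕜 κ A where
  toFun x := x + ∑' i, perturbTerm K l δ z x i
  map_add' x y := by
    have : perturbTerm K l δ z (x + y) =
        fun i => perturbTerm K l δ z x i + perturbTerm K l δ z y i := by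
      ext1 i
      simp only [perturbTerm, unitCoeff_add, add_smul]
      abel
    rw [this, (summable_perturbTerm K l hs x).tsum_add (summable_perturbTerm K l hs y)]
    abel
  map_smul' a x := by
    have : perturbTerm K l δ z (a • x) = fun i => a • perturbTerm K l δ z x i := by
      ext1 i
      simp only [perturbTerm, unitCoeff_smul, mul_smul, smul_add]
    rw [this, (summable_perturbTerm K l hs x).tsum_const_smul, RingHom.id_apply, smul_add]

lemma hasSum_perturb_sub (x : KotheSpace 𝕜 κ A) :
    HasSum (perturbTerm K l δ z x) (perturb K l hs x - x) := by
  have : perturb K l hs x - x = ∑' i, perturbTerm K l δ z x i := add_sub_cancel_left _ _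
  rw [this]
  exact (summable_perturbTerm K l hs x).hasSum

/-- The coefficients of normalized unit sequences are bounded by the norm `0`, so this norm alone
controls the perturbation in every norm `j`. -/
lemma seminorm_perturb_sub_le (j : ℕ) (x : KotheSpace 𝕜 κ A) :
    kotheSeminorm 𝕜 κ A j (perturb K l hs x - x) ≤ kotheSeminorm 𝕜 κ A 0 x *
      ∑' i, (kotheSeminorm 𝕜 κ A j (δ i) + kotheSeminorm 𝕜 κ A j (z i)) := by
  rw [← tsum_mul_left]
  exact seminorm_le_tsum (hasSum_perturb_sub K l hs x) ((hs j).mul_left _)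
    (seminorm_perturbTerm_le K l δ z j x)

lemma continuous_perturb : Continuous (perturb K l hs) := by
  refine WithSeminorms.continuous_of_isBounded (KotheSpace.withSeminorms κ A)
    (KotheSpace.withSeminorms κ A) _ fun j => ?_
  refine ⟨{0, j}, 1 + Real.toNNReal (∑' i, (kotheSeminorm 𝕜 κ A j (δ i) +
    kotheSeminorm 𝕜 κ A j (z i))), fun x => ?_⟩
  have h0 : 0 ≤ ∑' i, (kotheSeminorm 𝕜 κ A j (δ i) + kotheSeminorm 𝕜 κ A j (z i)) :=
    tsum_nonneg fun i => add_nonneg (apply_nonneg _ _) (apply_nonneg _ _)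
  have h1 := seminorm_perturb_sub_le K l hs j x
  have h2 := map_add_le_add (kotheSeminorm 𝕜 κ A j) (perturb K l hs x - x) x
  rw [sub_add_cancel] at h2
  have h3 : kotheSeminorm 𝕜 κ A 0 x ≤ (({0, j} : Finset ℕ).sup (kotheSeminorm 𝕜 κ A)) x :=
    Finset.le_sup (f := kotheSeminorm 𝕜 κ A) (by simp : 0 ∈ ({0, j} : Finset ℕ)) x
  have h4 : kotheSeminorm 𝕜 κ A j x ≤ (({0, j} : Finset ℕ).sup (kotheSeminorm 𝕜 κ A)) x :=
    Finset.le_sup (f := kotheSeminorm 𝕜 κ A) (by simp : j ∈ ({0, j} : Finset ℕ)) x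
  rw [smul_apply, NNReal.smul_def, smul_eq_mul, NNReal.coe_add, NNReal.coe_one,
    Real.coe_toNNReal _ h0]
  have h5 := mul_le_mul_of_nonneg_right h3 h0
  change kotheSeminorm 𝕜 κ A j (perturb K l hs x) ≤ _
  linarith

variable (hs0 : ∑' i, (kotheSeminorm 𝕜 κ A 0 (δ i) + kotheSeminorm 𝕜 κ A 0 (z i)) ≤ 1 / 2)

include hs0 in
lemma seminorm_zero_le_perturb (x : KotheSpace 𝕜 κ A) :
    kotheSeminorm 𝕜 κ A 0 x ≤ 2 * kotheSeminorm 𝕜 κ A 0 (perturb K l hs x) := by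
  have h1 := seminorm_perturb_sub_le K l hs 0 x
  have h2 := map_sub_le_add (kotheSeminorm 𝕜 κ A 0) (perturb K l hs x) (perturb K l hs x - x)
  rw [sub_sub_cancel] at h2
  have h3 := mul_le_mul_of_nonneg_left hs0 (apply_nonneg (kotheSeminorm 𝕜 κ A 0) x)
  linarith

include hs0 in
-- Smallness is needed only in the norm `0`: there the map is bounded below by `1 / 2`, and in the
-- norm `j` the perturbation is at most a multiple of the norm `0`, hence of the norm `j` of the
-- image.
lemma exists_seminorm_le_perturb (j : ℕ) : ∃ C > 0, ∀ x, kotheSeminorm 𝕜 κ A j x ≤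
    C * kotheSeminorm 𝕜 κ A j (perturb K l hs x) := by
  have h0 : 0 ≤ ∑' i, (kotheSeminorm 𝕜 κ A j (δ i) + kotheSeminorm 𝕜 κ A j (z i)) :=
    tsum_nonneg fun i => add_nonneg (apply_nonneg _ _) (apply_nonneg _ _)
  refine ⟨1 + 2 * ∑' i, (kotheSeminorm 𝕜 κ A j (δ i) + kotheSeminorm 𝕜 κ A j (z i)),
    by positivity, fun x => ?_⟩
  have h1 := seminorm_perturb_sub_le K l hs j x
  have h2 := map_sub_le_add (kotheSeminorm 𝕜 κ A j) (perturb K l hs x) (perturb K l hs x - x)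
  rw [sub_sub_cancel] at h2
  have h3 := (seminorm_zero_le_perturb K l hs hs0 x).trans
    (mul_le_mul_of_nonneg_left (seminorm_monotone (Nat.zero_le j) _) zero_le_two)
  have h4 := mul_le_mul_of_nonneg_right h3 h0
  linarith

include hs0 in
lemma perturb_injective : Function.Injective (perturb K l hs) := by
  refine (injective_iff_map_eq_zero _).2 fun x hx => ?_
  by_contra h
  have h1 := seminorm_zero_le_perturb K l hs hs0 x
  rw [hx, map_zero, mul_zero] at h1
  exact h1.not_gt (seminorm_zero_pos h)

include hs0 in
/-- The perturbed identity maps closed subspaces onto closed subspaces. -/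
theorem isClosed_map_perturb (U : Submodule 𝕜 (KotheSpace 𝕜 κ A))
    (hU : IsClosed (U : Set (KotheSpace 𝕜 κ A))) :
    IsClosed (U.map (perturb K l hs) : Set (KotheSpace 𝕜 κ A)) := by
  refine IsSeqClosed.isClosed fun y b hy hyb => ?_
  choose x hxU hxy using hy
  obtain ⟨a, ha⟩ := exists_tendsto_of_cauchy x fun j ε hε => by
    obtain ⟨C, hC, h⟩ := exists_seminorm_le_perturb K l hs hs0 j
    obtain ⟨N, hN⟩ := ((KotheSpace.withSeminorms κ A).tendsto_nhds_atTop _ _).1 hyb j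
      (ε / C / 2) (by positivity)
    refine ⟨N, fun m hm n hn => ?_⟩
    have h1 := hN m hm
    have h2 := hN n hn
    rw [map_sub_rev] at h2
    have h3 := map_add_le_add (kotheSeminorm 𝕜 κ A j) (y m - b) (b - y n)
    rw [sub_add_sub_cancel] at h3
    have h4 := h (x m - x n)
    rw [map_sub (perturb K l hs), hxy, hxy] at h4
    refine h4.trans ?_
    rw [← le_div_iff₀' hC]
    linarith
  refine ⟨a, hU.mem_of_tendsto ha (Eventually.of_forall hxU), ?_⟩
  refine tendsto_nhds_unique (((continuous_perturb K l hs).tendsto a).comp ha) ?_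
  exact hyb.congr fun n => (hxy n).symm

include hs0 in
lemma not_finiteDimensional_map_perturb (hK : StrictMono K) :
    ¬ FiniteDimensional 𝕜 ((supported 𝕜 κ A K).map (perturb K l hs)) := by
  intro hfin
  have h1 : LinearIndependent 𝕜 fun i => perturb K l hs (e 𝕜 κ A (K i)) :=
    (linearIndependent_e.comp K hK.injective).map' _
      (LinearMap.ker_eq_bot.2 (perturb_injective K l hs hs0))
  let v : ℕ → (supported 𝕜 κ A K).map (perturb K l hs) := fun i =>
    ⟨perturb K l hs (e 𝕜 κ A (K i)), Submodule.mem_map_of_mem (e_mem_supported K i)⟩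
  have h2 : LinearIndependent 𝕜 v := LinearIndependent.of_comp (Submodule.subtype _) h1
  exact not_finite_iff_infinite.2 inferInstance h2.finite

end Perturbation

end KotheSpace

/-! ### Orbits of the perturbed vectors -/

namespace KotheSpace

variable {κ : KotheKind} {A : KotheMatrix}
  {T : KotheSpace 𝕜 κ A →L[𝕜] KotheSpace 𝕜 κ A} {c : ℕ → 𝕜} {μ : ℕ → ℕ}
  {X₀ : Set (KotheSpace 𝕜 κ A)} {y : ℕ → KotheSpace 𝕜 κ A} {f : ℕ → Stage 𝕜 κ A}

lemma Stage.strictMono_k (hf : ∀ s, Valid T c μ X₀ y s f (f s)) : StrictMono fun s => (f s).k :=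
  strictMono_nat_of_lt_succ fun s => (hf (s + 1)).k_lt s (Nat.lt_succ_self s)

lemma Stage.seminorm_add_le (hf : ∀ s, Valid T c μ X₀ y s f (f s)) {j s : ℕ} (hjs : j ≤ s) :
    kotheSeminorm 𝕜 κ A j ((f s).v - unit 𝕜 κ A (f s).k) + kotheSeminorm 𝕜 κ A j (f s).z ≤
      1 / 8 * (1 / 2) ^ s := by
  have h1 := (seminorm_monotone hjs _).trans (hf s).v_le
  have h2 := (seminorm_monotone hjs _).trans (hf s).z_le
  rw [pow_add] at h1 h2
  linarith

lemma Stage.summable (hf : ∀ s, Valid T c μ X₀ y s f (f s)) (j : ℕ) :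
    Summable fun s => kotheSeminorm 𝕜 κ A j ((f s).v - unit 𝕜 κ A (f s).k) +
      kotheSeminorm 𝕜 κ A j (f s).z := by
  refine Summable.of_norm_bounded_eventually_nat (summable_geometric_two.mul_left (1 / 8)) ?_
  filter_upwards [eventually_ge_atTop j] with s hs
  rw [Real.norm_of_nonneg (add_nonneg (apply_nonneg _ _) (apply_nonneg _ _))]
  exact seminorm_add_le hf hs

lemma Stage.tsum_le (hf : ∀ s, Valid T c μ X₀ y s f (f s)) :
    ∑' s, (kotheSeminorm 𝕜 κ A 0 ((f s).v - unit 𝕜 κ A (f s).k) +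
      kotheSeminorm 𝕜 κ A 0 (f s).z) ≤ 1 / 2 := by
  refine ((summable hf 0).tsum_le_tsum (fun s => seminorm_add_le hf (Nat.zero_le s))
    (summable_geometric_two.mul_left (1 / 8))).trans ?_
  rw [tsum_mul_left, tsum_geometric_two]
  norm_num

/-- The tail of the expansion of a sequence supported on the chosen indices. -/
def tail (K : ℕ → ℕ) (s : ℕ) (x : KotheSpace 𝕜 κ A) : KotheSpace 𝕜 κ A :=
  x - ∑ i ∈ Finset.range s, x.coord (K i) • e 𝕜 κ A (K i)

lemma hasSum_tail {K : ℕ → ℕ} (hK : StrictMono K) {x : KotheSpace 𝕜 κ A}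
    (hx : x ∈ supported 𝕜 κ A K) (s : ℕ) :
    HasSum (fun i => if i < s then 0 else x.coord (K i) • e 𝕜 κ A (K i)) (tail K s x) := by
  have h1 := hasSum_sum_of_ne_finset_zero (L := .unconditional ℕ) (s := Finset.range s)
    (f := fun i => if i < s then x.coord (K i) • e 𝕜 κ A (K i) else 0) fun i hi => by
      rw [if_neg (by simpa using hi)]
  have h2 := (hasSum_supported hK hx).sub h1
  rw [Finset.sum_congr rfl fun i hi => if_pos (Finset.mem_range.1 hi)] at h2
  refine h2.congr_fun fun i => ?_
  split_ifs <;> simp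

lemma tendsto_seminorm_tail {K : ℕ → ℕ} (hK : StrictMono K) {x : KotheSpace 𝕜 κ A}
    (hx : x ∈ supported 𝕜 κ A K) (j : ℕ) :
    Tendsto (fun s => kotheSeminorm 𝕜 κ A j (tail K s x)) atTop (𝓝 0) := by
  have h1 : Tendsto (fun s => tail K s x) atTop (𝓝 (x - x)) :=
    (hasSum_supported hK hx).tendsto_sum_nat.const_sub x
  rw [sub_self] at h1
  have h2 := ((continuous_seminorm j).tendsto 0).comp h1
  rwa [map_zero] at h2

lemma seminorm_smul_add_smul_le {j : ℕ} {a b : 𝕜} {x z : KotheSpace 𝕜 κ A} {R ε : ℝ}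
    (ha : ‖a‖ ≤ R) (hb : ‖b‖ ≤ R) (hx : kotheSeminorm 𝕜 κ A j x ≤ ε)
    (hz : kotheSeminorm 𝕜 κ A j z ≤ ε) :
    kotheSeminorm 𝕜 κ A j (a • x + b • z) ≤ 2 * R * ε := by
  have hR : 0 ≤ R := (norm_nonneg a).trans ha
  have h1 := mul_le_mul ha hx (apply_nonneg _ _) hR
  have h2 := mul_le_mul hb hz (apply_nonneg _ _) hR
  refine (map_add_le_add _ _ _).trans ?_
  rw [map_smul_eq_mul, map_smul_eq_mul]
  linarith

/-- The difference between the image of a perturbed vector under the power of stage `s` and the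
multiple of the target of stage `s` is controlled by a tail of the vector. -/
theorem Stage.seminorm_apply_sub_le (hf : ∀ s, Valid T c μ X₀ y s f (f s)) (hc : ∀ n, ‖c n‖ ≤ 1)
    (l : ℕ → ℕ) {x : KotheSpace 𝕜 κ A} (hx : x ∈ supported 𝕜 κ A fun s => (f s).k)
    {j s : ℕ} (hjs : j ≤ s) :
    kotheSeminorm 𝕜 κ A j ((T ^ (f s).n) (perturb (fun s => (f s).k) l (summable hf) x) -
        unitCoeff (f (l s)).k x • y s) ≤
      (kotheSeminorm 𝕜 κ A (μ j) x + 2 * kotheSeminorm 𝕜 κ A 0 x) * (2 * (1 / 2) ^ s) +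
        kotheSeminorm 𝕜 κ A j (tail (fun s => (f s).k) s x) := by
  have hK := strictMono_k hf
  set K : ℕ → ℕ := fun s => (f s).k
  set n := (f s).n
  have h1 := ((hasSum_supported hK hx).add (hasSum_perturb_sub K l (summable hf) x)).mapL (T ^ n)
  rw [add_sub_cancel] at h1
  -- The target is attached to the index `i = s` and the tail is spread over `i ≥ s`, so that the
  -- difference can be estimated term by term against a geometric series.
  have h2 := (h1.sub (hasSum_ite_eq s (unitCoeff (K (l s)) x • y s))).sub
    ((hasSum_tail hK hx s).const_smul (c n))
  have hgeom : Summable fun i : ℕ => (kotheSeminorm 𝕜 κ A (μ j) x +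
      2 * kotheSeminorm 𝕜 κ A 0 x) * ((1 / 2) ^ s * (1 / 2) ^ i) :=
    (summable_geometric_two.mul_left _).mul_left _
  have hle : ∀ i, ∀ w, w = (T ^ n) (x.coord (K i) • e 𝕜 κ A (K i) + perturbTerm K l
      (fun s => (f s).v - unit 𝕜 κ A (f s).k) (fun s => (f s).z) x i) -
      (if i = s then unitCoeff (K (l s)) x • y s else 0) -
      c n • (if i < s then 0 else x.coord (K i) • e 𝕜 κ A (K i)) →
      kotheSeminorm 𝕜 κ A j w ≤ (kotheSeminorm 𝕜 κ A (μ j) x +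
        2 * kotheSeminorm 𝕜 κ A 0 x) * ((1 / 2) ^ s * (1 / 2) ^ i) := by
    rintro i w rfl
    have hμ0 : 0 ≤ kotheSeminorm 𝕜 κ A (μ j) x := apply_nonneg _ _
    have hpow : (0 : ℝ) ≤ (1 / 2) ^ s * (1 / 2) ^ i := by positivity
    rcases lt_or_ge i s with hi | hi
    · have h3 : (T ^ n) (x.coord (K i) • e 𝕜 κ A (K i) + perturbTerm K l
          (fun s => (f s).v - unit 𝕜 κ A (f s).k) (fun s => (f s).z) x i) -
          (if i = s then unitCoeff (K (l s)) x • y s else 0) -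
          c n • (if i < s then 0 else x.coord (K i) • e 𝕜 κ A (K i)) =
          unitCoeff (K i) x • (T ^ n) (f i).v + unitCoeff (K (l i)) x • (T ^ n) (f i).z := by
        rw [if_neg hi.ne, if_pos hi, perturbTerm, smul_sub, ← unitCoeff_smul_unit, smul_zero,
          sub_zero, sub_zero, ← map_smul, ← map_smul, ← map_add]
        congr 1
        abel
      rw [h3]
      have h4 := (seminorm_monotone hjs _).trans ((hf s).old_v i hi)
      have h5 := (seminorm_monotone hjs _).trans ((hf s).old_z i hi)
      have h6 := seminorm_smul_add_smul_le (norm_unitCoeff_le (K i) x)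
        (norm_unitCoeff_le (K (l i)) x) h4 h5
      rw [pow_add] at h6
      have := mul_nonneg hμ0 hpow
      linarith
    · have hni : n = (f i).n ∨ ∃ m < i, n = (f m).n := by
        rcases hi.eq_or_lt with rfl | hi
        · exact Or.inl rfl
        · exact Or.inr ⟨s, hi, rfl⟩
      have hii : ((1 : ℝ) / 2) ^ (i + i) ≤ (1 / 2) ^ s * (1 / 2) ^ i := by
        rw [pow_add]
        exact mul_le_mul_of_nonneg_right
          (pow_le_pow_of_le_one (by norm_num) (by norm_num) hi) (by positivity)
      -- From stage `s` on, the unit sequence stays and acts through `T ^ n - c n`; its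
      -- approximation error and `z` are treated separately, and only `i = s` carries a target.
      have h3 : (T ^ n) (x.coord (K i) • e 𝕜 κ A (K i) + perturbTerm K l
          (fun s => (f s).v - unit 𝕜 κ A (f s).k) (fun s => (f s).z) x i) -
          (if i = s then unitCoeff (K (l s)) x • y s else 0) -
          c n • (if i < s then 0 else x.coord (K i) • e 𝕜 κ A (K i)) =
          x.coord (K i) • ((T ^ n) (e 𝕜 κ A (K i)) - c n • e 𝕜 κ A (K i)) +
          (unitCoeff (K i) x • (T ^ n) ((f i).v - unit 𝕜 κ A (f i).k) +
          unitCoeff (K (l i)) x • ((T ^ n) (f i).z - if i = s then y s else 0)) := by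
        have h4 : (if i = s then unitCoeff (K (l s)) x • y s else 0) =
            unitCoeff (K (l i)) x • if i = s then y s else 0 := by
          split_ifs with h
          · rw [h]
          · rw [smul_zero]
        rw [h4, if_neg hi.not_gt, perturbTerm, map_add, map_add, map_smul, map_smul, map_smul,
          smul_sub (x.coord (K i)), smul_sub (unitCoeff (K (l i)) x), smul_comm (c n)]
        abel
      rw [h3]
      have h4 : kotheSeminorm 𝕜 κ A j ((T ^ n) (f i).z - if i = s then y s else 0) ≤
          (1 / 2) ^ s * (1 / 2) ^ i := by
        rcases hi.eq_or_lt with rfl | hi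
        · rw [if_pos rfl, ← pow_add]
          exact (seminorm_monotone hjs _).trans (hf s).z_target
        · rw [if_neg hi.ne', sub_zero, ← pow_add]
          exact (seminorm_monotone (hjs.trans hi.le) _).trans ((hf i).z_new s hi)
      have h5 := ((seminorm_monotone (hjs.trans hi) _).trans ((hf i).v_new n hni)).trans hii
      have h6 := seminorm_smul_add_smul_le (norm_unitCoeff_le (K i) x)
        (norm_unitCoeff_le (K (l i)) x) h5 h4
      have h7 : kotheSeminorm 𝕜 κ A j (x.coord (K i) •
          ((T ^ n) (e 𝕜 κ A (K i)) - c n • e 𝕜 κ A (K i))) ≤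
          kotheSeminorm 𝕜 κ A (μ j) x * ((1 / 2) ^ s * (1 / 2) ^ i) := by
        rw [map_smul_eq_mul]
        calc _ ≤ ‖x.coord (K i)‖ * ((1 / 2) ^ (i + i) * A.a (μ j) (K i)) :=
              mul_le_mul_of_nonneg_left ((hf i).e_le n hni j (hjs.trans hi)) (norm_nonneg _)
          _ = ‖x.coord (K i)‖ * A.a (μ j) (K i) * (1 / 2) ^ (i + i) := by ring
          _ ≤ _ := mul_le_mul (coord_le _ _ _) hii (by positivity) hμ0
      refine (map_add_le_add _ _ _).trans ((add_le_add h7 h6).trans_eq ?_)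
      ring
  have h8 := seminorm_le_tsum h2 hgeom fun i => hle i _ rfl
  rw [tsum_mul_left, tsum_mul_left, tsum_geometric_two] at h8
  have h9 := map_add_le_add (kotheSeminorm 𝕜 κ A j)
    ((T ^ n) (perturb K l (summable hf) x) - unitCoeff (K (l s)) x • y s - c n • tail K s x)
    (c n • tail K s x)
  rw [sub_add_cancel, map_smul_eq_mul] at h9
  have h10 := mul_le_mul_of_nonneg_right (hc n)
    (apply_nonneg (kotheSeminorm 𝕜 κ A j) (tail K s x))
  linarith

/-- An operator on a Köthe space that satisfies the Hypercyclicity Criterion and whose powers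
are, along suitable unit sequences, small perturbations of contractive multiples of the identity
has a hypercyclic subspace. -/
theorem hasHypercyclicSubspace (hT : SatisfiesHypercyclicityCriterion T) (hc : ∀ n, ‖c n‖ ≤ 1)
    (hμ : ∀ N, ∀ ε > 0, ∃ᶠ k in atTop, ∀ n ≤ N, ∀ j ≤ N, kotheSeminorm 𝕜 κ A j
      ((T ^ n) (e 𝕜 κ A k) - c n • e 𝕜 κ A k) ≤ ε * A.a (μ j) k) :
    HasHypercyclicSubspace T := by
  obtain ⟨X₀, Y₀, n, S, hX₀, hY₀, hn, hTn, hS, hTS⟩ := hT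
  obtain ⟨D, hD⟩ := TopologicalSpace.exists_dense_seq (KotheSpace 𝕜 κ A)
  obtain ⟨f, hf⟩ := exists_seq_of_strong_rec
    (Stage.Valid T c μ X₀ fun s => D s.unpair.1.unpair.2) (fun s f g d => Stage.Valid.congr)
    (exists_stage hX₀ hY₀ hn hTn hS hTS hμ _)
  have hK := Stage.strictMono_k hf
  set K : ℕ → ℕ := fun s => (f s).k
  set l : ℕ → ℕ := fun s => s.unpair.1.unpair.1 with hl
  refine ⟨(supported 𝕜 κ A K).map (perturb K l (Stage.summable hf)),
    isClosed_map_perturb K l _ (Stage.tsum_le hf) _ (isClosed_supported K),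
    not_finiteDimensional_map_perturb K l _ (Stage.tsum_le hf) hK, ?_⟩
  rintro _ ⟨x, hx, rfl⟩ hx0
  obtain ⟨i, hi⟩ : ∃ i, unitCoeff (K i) x ≠ 0 := by
    by_contra! h
    have hx' : x = 0 := by
      refine (hasSum_supported hK hx).unique ?_
      simp only [← unitCoeff_smul_unit, h, zero_smul]
      exact hasSum_zero
    exact hx0 (by rw [hx', map_zero])
  intro b
  refine mem_closure_of_seminorm fun j ε hε => ?_
  obtain ⟨t, ht⟩ : ∃ t, kotheSeminorm 𝕜 κ A j (unitCoeff (K i) x • D t - b) < ε / 2 := by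
    have h1 : Continuous fun d => kotheSeminorm 𝕜 κ A j (unitCoeff (K i) x • d - b) :=
      (continuous_seminorm j).comp ((continuous_const_smul _).sub continuous_const)
    refine hD.exists_mem_open (isOpen_lt h1 continuous_const) ⟨(unitCoeff (K i) x)⁻¹ • b, ?_⟩
    simp [smul_smul, mul_inv_cancel₀ hi, hε]
  have h2 : Tendsto (fun s => (kotheSeminorm 𝕜 κ A (μ j) x + 2 * kotheSeminorm 𝕜 κ A 0 x) *
      (2 * (1 / 2) ^ s) + kotheSeminorm 𝕜 κ A j (tail K s x)) atTop (𝓝 0) := by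
    have h3 := ((tendsto_pow_atTop_nhds_zero_of_lt_one (by norm_num : (0 : ℝ) ≤ 1 / 2)
      (by norm_num)).const_mul 2).const_mul
        (kotheSeminorm 𝕜 κ A (μ j) x + 2 * kotheSeminorm 𝕜 κ A 0 x)
    simpa using h3.add (tendsto_seminorm_tail hK hx j)
  obtain ⟨N, hN⟩ := eventually_atTop.1
    ((h2.eventually_lt_const (half_pos hε)).and (eventually_ge_atTop j))
  obtain ⟨h3, h4⟩ := hN (Nat.pair (Nat.pair i t) N) (Nat.right_le_pair _ _)
  have h5 := Stage.seminorm_apply_sub_le hf hc l hx h4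
  -- The stage encodes the coefficient `i` and the target `t`; the last entry `N` only pushes it far
  -- enough out.
  have hl' : l (Nat.pair (Nat.pair i t) N) = i := by simp [hl]
  have hD' : D (Nat.pair (Nat.pair i t) N).unpair.1.unpair.2 = D t := by simp
  rw [hl', hD'] at h5
  refine ⟨_, ⟨_, (hf (Nat.pair (Nat.pair i t) N)).one_le_n, rfl⟩, ?_⟩
  have h6 := map_add_le_add (kotheSeminorm 𝕜 κ A j)
    ((T ^ (f (Nat.pair (Nat.pair i t) N)).n) (perturb K l (Stage.summable hf) x) -
      unitCoeff (K i) x • D t) (unitCoeff (K i) x • D t - b)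
  rw [sub_add_sub_cancel] at h6
  exact h6.trans_lt (by linarith)

end KotheSpace

/-! ### Unit sequences and entries of the matrix -/

lemma exists_eventually_le_of_iSup_limsup_lt {r : ℕ → ℕ → ℝ}
    (h : (⨆ n : ℕ, limsup (fun k : ℕ => ENNReal.ofReal (r n k)) atTop) < ∞) :
    ∃ C > 0, ∀ n, ∀ᶠ k in atTop, r n k ≤ C := by
  refine ⟨(⨆ n : ℕ, limsup (fun k : ℕ => ENNReal.ofReal (r n k)) atTop).toReal + 1,
    by positivity, fun n => ?_⟩
  have h1 : limsup (fun k : ℕ => ENNReal.ofReal (r n k)) atTop <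
      ENNReal.ofReal ((⨆ n : ℕ, limsup (fun k => ENNReal.ofReal (r n k)) atTop).toReal + 1) := by
    refine (le_iSup (fun n => limsup (fun k : ℕ => ENNReal.ofReal (r n k)) atTop) n).trans_lt ?_
    rw [ENNReal.lt_ofReal_iff_toReal_lt h.ne]
    exact lt_add_one _
  filter_upwards [eventually_lt_of_limsup_lt h1] with k hk
  exact (ENNReal.ofReal_le_ofReal_iff (by positivity)).1 hk.le

/-- A positive sequence stays away from `0` on any initial segment, so a zero infimum can only come
from arbitrarily late terms. -/
lemma frequently_le_of_iInf_eq_zero {r : ℕ → ℝ} (hr : ∀ k, 0 < r k) (h : ⨅ k, r k = 0) {ε : ℝ}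
    (hε : 0 < ε) : ∃ᶠ k in atTop, r k ≤ ε := by
  rw [frequently_atTop]
  intro N
  obtain ⟨δ, hδ, hδN⟩ : ∃ δ > 0, ∀ k < N, δ ≤ r k := by
    induction N with
    | zero => exact ⟨1, one_pos, by simp⟩
    | succ N ih =>
      obtain ⟨δ, hδ, h⟩ := ih
      refine ⟨min δ (r N), lt_min hδ (hr N), fun k hk => ?_⟩
      rcases Nat.lt_succ_iff_lt_or_eq.1 hk with hk | rfl
      · exact (min_le_left _ _).trans (h k hk)
      · exact min_le_right _ _
  obtain ⟨k, hk⟩ := exists_lt_of_ciInf_lt (h.trans_lt (lt_min hδ hε))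
  refine ⟨k, ?_, (hk.trans_le (min_le_right _ _)).le⟩
  by_contra! hkN
  exact absurd (hδN k hkN) (not_le.2 (hk.trans_le (min_le_left _ _)))

lemma prod_Icc_one_eq_prod_range (g : ℕ → ℝ) (n : ℕ) :
    ∏ ν ∈ Finset.Icc 1 n, g ν = ∏ ν ∈ Finset.range n, g (ν + 1) := by
  induction n with
  | zero => simp
  | succ n ih => rw [Finset.prod_Icc_succ_top (by omega), Finset.prod_range_succ, ih]

/-- A polynomial of a weighted shift has a hypercyclic subspace under conditions on the entries
of the Köthe matrix. -/
theorem IsWeightedShift.hasHypercyclicSubspace {κ : KotheKind} {A : KotheMatrix} {w : ℕ → 𝕜}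
    {B : KotheSpace 𝕜 κ A →L[𝕜] KotheSpace 𝕜 κ A} (hB : IsWeightedShift w B) (P : 𝕜[X])
    (hP : SatisfiesHypercyclicityCriterion (aeval B P)) (J : ℕ)
    (ha : ∀ m j : ℕ, ∃ m' : ℕ, ∃ C > 0, ∀ n, ∀ᶠ k in atTop,
      (A.a j k * A.a m (n + k)) / (A.a J k * A.a m' (n + k)) ≤ C)
    (hb : ∃ m : ℕ, ∀ n : ℕ, 1 ≤ n →
      (⨅ k : ℕ, (∏ ν ∈ Finset.Icc 1 n, ‖w (ν + k)‖) * A.a J k / A.a m (n + k)) = 0)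
    (hc : ‖P.coeff 0‖ ≤ 1 ∨ ∃ m : ℕ, Tendsto (fun k => A.a J k / A.a m k) atTop (𝓝 0)) :
    HasHypercyclicSubspace (aeval B P) := by
  obtain ⟨c, hc1, μ, hμ⟩ := hB.exists_frequently_seminorm_le P J (by
    intro m j
    obtain ⟨m', C, hC, h⟩ := ha m j
    refine ⟨m', C, hC, fun n => (h n).mono fun k hk => ?_⟩
    rwa [div_le_iff₀ (mul_pos (A.pos _ _) (A.pos _ _))] at hk) (by
    obtain ⟨m, h⟩ := hb
    refine ⟨m, fun n hn ε hε => ?_⟩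
    refine (frequently_le_of_iInf_eq_zero (fun k => ?_) (h n hn) hε).mono fun k hk => ?_
    · exact div_pos (mul_pos (Finset.prod_pos fun _ _ => norm_pos_iff.2 (hB.weight_ne_zero _))
        (A.pos _ _)) (A.pos _ _)
    · have h1 : weightProd w (n + k) =
          weightProd w k * ∏ ν ∈ Finset.Icc 1 n, ‖w (ν + k)‖ := by
        rw [add_comm, weightProd, weightProd, Finset.prod_range_add, prod_Icc_one_eq_prod_range]
        simp [add_assoc, add_comm]
      have h2 := hB.weightProd_pos k
      have h3 := hB.weightProd_pos (n + k)
      rw [div_le_iff₀ (A.pos _ _)] at hk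
      rw [mul_div_assoc', div_le_div_iff₀ h2 h3, h1]
      calc _ = (∏ ν ∈ Finset.Icc 1 n, ‖w (ν + k)‖) * A.a J k * weightProd w k := by ring
        _ ≤ _ := mul_le_mul_of_nonneg_right hk h2.le) hc
  exact KotheSpace.hasHypercyclicSubspace hP hc1 hμ

lemma IsWeightedShift.seminorm_pow_apply_e_add {κ : KotheKind} {A : KotheMatrix} {w : ℕ → 𝕜}
    {B : KotheSpace 𝕜 κ A →L[𝕜] KotheSpace 𝕜 κ A} (hB : IsWeightedShift w B) (j n k : ℕ) :
    kotheSeminorm 𝕜 κ A j ((B ^ n) (KotheSpace.e 𝕜 κ A (n + k))) =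
      (∏ ν ∈ Finset.Icc 1 n, ‖w (ν + k)‖) * A.a j k := by
  rw [add_comm n k, hB.pow_apply_e, map_smul_eq_mul, KotheSpace.seminorm_e, norm_prod,
    prod_Icc_one_eq_prod_range]
  simp [add_comm]

end

theorem theorem5p2 {𝕜 : Type*} [RCLike 𝕜] (κ : KotheKind) (A : KotheMatrix) (w : ℕ → 𝕜)
    (B : KotheSpace 𝕜 κ A →L[𝕜] KotheSpace 𝕜 κ A) (hB : IsWeightedShift w B)
    (P : 𝕜[X]) (hP : 0 < P.natDegree)
    (hHC : SatisfiesHypercyclicityCriterion (aeval B P))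
    (p : ℕ → Seminorm 𝕜 (KotheSpace 𝕜 κ A)) (hp : p = kotheSeminorm 𝕜 κ A)
    (e : ℕ → KotheSpace 𝕜 κ A) (he : e = KotheSpace.e 𝕜 κ A) (J : ℕ) :
    -- the version in terms of the norms of the unit sequences
    ((∀ m j : ℕ, ∃ m' : ℕ,
        (⨆ n : ℕ, limsup (fun k : ℕ => ENNReal.ofReal
          ((p j (e (k - n)) * p m (e k)) / (p J (e (k - n)) * p m' (e k)))) atTop) < ∞) →
     (∃ m : ℕ, ∀ n : ℕ, 1 ≤ n →
        (⨅ k : Set.Ici n, p J ((B ^ n) (e k)) / p m (e k)) = 0) →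
     (‖P.coeff 0‖ ≤ 1 ∨ ∃ m : ℕ, Tendsto (fun k => p J (e k) / p m (e k)) atTop (𝓝 0)) →
     HasHypercyclicSubspace (aeval B P)) ∧
    -- the version in terms of the entries of the matrix
    ((∀ m j : ℕ, ∃ m' : ℕ,
        (⨆ n : ℕ, limsup (fun k : ℕ => ENNReal.ofReal
          ((A.a j k * A.a m (n + k)) / (A.a J k * A.a m' (n + k)))) atTop) < ∞) →
     (∃ m : ℕ, ∀ n : ℕ, 1 ≤ n →
        (⨅ k : ℕ, (∏ ν ∈ Finset.Icc 1 n, ‖w (ν + k)‖) * A.a J k / A.a m (n + k)) = 0) →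
     (‖P.coeff 0‖ ≤ 1 ∨ ∃ m : ℕ, Tendsto (fun k => A.a J k / A.a m k) atTop (𝓝 0)) →
     HasHypercyclicSubspace (aeval B P)) := by
  subst hp he
  simp only [KotheSpace.seminorm_e]
  refine ⟨fun ha hb hc => ?_, fun ha hb hc => ?_⟩
  · refine hB.hasHypercyclicSubspace P hHC J (fun m j => ?_) ?_ hc
    · obtain ⟨m', h⟩ := ha m j
      obtain ⟨C, hC, hC'⟩ := exists_eventually_le_of_iSup_limsup_lt h
      refine ⟨m', C, hC, fun n => ?_⟩
      -- Substituting `k + n` for `k` removes the truncated subtraction and turns the first version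
      -- of (a) into the second.
      filter_upwards [(tendsto_add_atTop_nat n).eventually (hC' n)] with k hk
      rwa [Nat.add_sub_cancel, add_comm k n] at hk
    · obtain ⟨m, h⟩ := hb
      refine ⟨m, fun n hn => ?_⟩
      have hsurj : Function.Surjective fun k : ℕ => (⟨n + k, by simp⟩ : Set.Ici n) := by
        rintro ⟨k, hk⟩
        exact ⟨k - n, Subtype.ext (Nat.add_sub_cancel' hk)⟩
      rw [← h n hn, ← hsurj.iInf_comp]
      simp only [hB.seminorm_pow_apply_e_add]
  · refine hB.hasHypercyclicSubspace P hHC J (fun m j => ?_) hb hc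
    obtain ⟨m', h⟩ := ha m j
    exact ⟨m', exists_eventually_le_of_iSup_limsup_lt h⟩
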